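/- Let $N$ be a von Neumann algebra on a Hilbert space $H$ equipped with a faithful normal semifinite trace $\tau : N_+ \to [0,\infty]$. Let $\mathcal F_N$ be the two-sided ideal of $N$ generated by the projections $p\in N$ with $\tau(p)<\infty$, let $\mathcal K_N$ (the $\tau$-compact operators) be the norm closure of $\mathcal F_N$, and write $\tau$ also for the canonical linear extension of the trace to $\mathcal F_N$, $$\tau(x)=\tau\big((\mathrm{Re}\,x)_+\big)-\tau\big((\mathrm{Re}\,x)_-\big)+i\,\tau\big((\mathrm{Im}\,x)_+\big)-i\,\tau\big((\mathrm{Im}\,x)_-\big).$$ Put $\tau_n(x)=\sum_{i=1}^n\tau(x_{ii})$ for $x\in M_n(\mathcal F_N)$, and use the same formula, with values in $[0,\infty]$, for positive $x \in M_n(N)$. Let $\mathcal K_N^+$ be the unitization of $\mathcal K_N$, with elements $x+\lambda$ ($x\in\mathcal K_N$, $\lambda\in\mathbb C$), let $\mathcal F_N^+=\{x+\lambda : x\in\mathcal F_N,\ \lambda\in\mathbb C\}\subseteq\mathcal K_N^+$, and let $K_0(\mathcal K_N)=\ker\big(K_0(\mathcal K_N^+)\to K_0(\mathbb C)\big)$,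 the map being induced by $x+\lambda\mapsto\lambda$. Here $K_0$ of a unital $*$-algebra $A$ is the Grothendieck group of the Murray–von Neumann equivalence classes of projections in the matrix algebras $M_n(A)$, $n \geq 0$, under block diagonal sum. (1) For every $n$, every projection $p\in M_n(\mathcal K_N)$ lies in $M_n(\mathcal F_N)$, and $\tau_n(p)<\infty$. (2) There is a unique group homomorphism $\tau_* : K_0(\mathcal K_N)\to\mathbb R$ such that $$\tau_*\big([x+\lambda]-[y+\mu]\big)=\tau_n(x)-\tau_n(y)$$ for every $n$ and all projections $x+\lambda,\ y+\mu\in M_n(\mathcal F_N^+)$ (with $x,y\in M_n(\mathcal F_N)$ and $\lambda,\mu\in M_n(\mathbb C)$) satisfying $[\lambda]=[\mu]$ in $K_0(\mathbb C)$. -/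

import Mathlib

open scoped ENNReal NNReal

noncomputable section

/-! ### K-theory of a unital star-algebra, and of a non-unital one -/

/-- A projection (self-adjoint idempotent) in a matrix algebra over `A`, of some finite size. -/
structure ProjMat (A : Type*) [Ring A] [StarRing A] where
  /-- the size of the matrix -/
  size : ℕ
  /-- the matrix -/
  mat : Matrix (Fin size) (Fin size) A
  isProj : IsStarProjection mat

namespace ProjMat

variable {A : Type*} [Ring A] [StarRing A]

/-- Murray-von Neumann equivalence of projections of possibly different sizes:
`p = v* v` and `q = v v*` for a rectangular matrix `v` over `A`. -/
def MvN (p q : ProjMat A) : Prop :=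
  ∃ v : Matrix (Fin q.size) (Fin p.size) A,
    v.conjTranspose * v = p.mat ∧ v * v.conjTranspose = q.mat

/-- The block diagonal sum `diag (p, q)`. -/
def dsum (p q : ProjMat A) : ProjMat A where
  size := p.size + q.size
  mat := (Matrix.fromBlocks p.mat 0 0 q.mat).submatrix finSumFinEquiv.symm finSumFinEquiv.symm
  isProj := by
    constructor
    · have hp : p.mat * p.mat = p.mat := p.isProj.isIdempotentElem
      have hq : q.mat * q.mat = q.mat := q.isProj.isIdempotentElem
      simp [IsIdempotentElem, Matrix.submatrix_mul_equiv, Matrix.fromBlocks_multiply, hp, hq]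
    · have hp : p.mat.conjTranspose = p.mat := p.isProj.isSelfAdjoint
      have hq : q.mat.conjTranspose = q.mat := q.isProj.isSelfAdjoint
      simp [IsSelfAdjoint, Matrix.star_eq_conjTranspose, Matrix.fromBlocks_conjTranspose, hp, hq]

/-- The image of a projection under a star-homomorphism, applied entrywise. -/
def map {A B : Type*} [Ring A] [StarRing A] [Algebra ℂ A] [Ring B] [StarRing B] [Algebra ℂ B]
    (f : A →⋆ₐ[ℂ] B) (p : ProjMat A) : ProjMat B where
  size := p.size
  mat := p.mat.map f
  isProj := by
    constructor
    · have hp : p.mat * p.mat = p.mat := p.isProj.isIdempotentElem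
      have h := Matrix.map_mul (f := (f : A →+* B)) (M := p.mat) (L := p.mat)
      rw [hp] at h
      exact h.symm
    · have hp : p.mat.conjTranspose = p.mat := p.isProj.isSelfAdjoint
      have h := Matrix.conjTranspose_map (A := p.mat) f (fun x => map_star f x)
      rw [hp] at h
      exact h.symm

end ProjMat

/-- The defining relations of `K₀`: equivalent projections have the same class, and the class of
`diag (p, q)` is the sum of the classes of `p` and `q`. -/
def kZeroRel (A : Type*) [Ring A] [StarRing A] : Set (FreeAbelianGroup (ProjMat A)) :=
  {z | ∃ p q : ProjMat A, p.MvN q ∧ z = FreeAbelianGroup.of p - FreeAbelianGroup.of q} ∪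
  {z | ∃ p q : ProjMat A, z = FreeAbelianGroup.of (p.dsum q) -
    (FreeAbelianGroup.of p + FreeAbelianGroup.of q)}

/-- `K₀` of a unital star-algebra `A`: the abelian group generated by the projections in
the matrix algebras over `A` modulo Murray-von Neumann equivalence and `[diag (p, q)] = [p] + [q]`.
This is the Grothendieck group of the monoid of equivalence classes of projections. -/
abbrev KZeroUnital (A : Type*) [Ring A] [StarRing A] : Type _ :=
  FreeAbelianGroup (ProjMat A) ⧸ AddSubgroup.closure (kZeroRel A)

namespace KZeroUnital

/-- The class `[p]`. -/
def mk {A : Type*} [Ring A] [StarRing A] (p : ProjMat A) : KZeroUnital A :=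
  QuotientAddGroup.mk (FreeAbelianGroup.of p)

variable {A B : Type*} [Ring A] [StarRing A] [Algebra ℂ A] [Ring B] [StarRing B] [Algebra ℂ B]

/-- The homomorphism `K₀(A) → K₀(B)`, `[p] ↦ [f(p)]`, induced by a unital star-homomorphism. -/
def map (f : A →⋆ₐ[ℂ] B) : KZeroUnital A →+ KZeroUnital B :=
  QuotientAddGroup.map _ _ (FreeAbelianGroup.map (ProjMat.map f)) <| by
    rw [AddSubgroup.closure_le]
    rintro z (⟨p, q, ⟨v, hv, hv'⟩, rfl⟩ | ⟨p, q, rfl⟩)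
    · refine AddSubgroup.subset_closure (Or.inl ⟨p.map f, q.map f, ⟨v.map f, ?_, ?_⟩, ?_⟩)
      · have h := Matrix.map_mul (f := (f : A →+* B)) (L := v.conjTranspose) (M := v)
        rw [hv] at h
        have key : (v.map f).conjTranspose * v.map f = p.mat.map f := by
          rw [← Matrix.conjTranspose_map (A := v) f (fun x => map_star f x)]
          exact h.symm
        exact key
      · have h := Matrix.map_mul (f := (f : A →+* B)) (L := v) (M := v.conjTranspose)
        rw [hv'] at h
        have key : v.map f * (v.map f).conjTranspose = q.mat.map f := by
          rw [← Matrix.conjTranspose_map (A := v) f (fun x => map_star f x)]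
          exact h.symm
        exact key
      · simp
    · refine AddSubgroup.subset_closure (Or.inr ⟨p.map f, q.map f, ?_⟩)
      have h : (p.dsum q).map f = (p.map f).dsum (q.map f) := by
        simp only [ProjMat.map, ProjMat.dsum, ProjMat.mk.injEq, heq_eq_eq, true_and]
        rw [← Matrix.submatrix_map, Matrix.fromBlocks_map, Matrix.map_zero _ (map_zero f),
          Matrix.map_zero _ (map_zero f)]
        rfl
      simp [h]

theorem map_mk (f : A →⋆ₐ[ℂ] B) (p : ProjMat A) : map f (mk p) = mk (p.map f) := by
  simp [map, mk]

end KZeroUnital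

section NonUnital

variable (J : Type*) [NonUnitalRing J] [StarRing J] [Module ℂ J] [IsScalarTower ℂ J J]
  [SMulCommClass ℂ J J] [StarModule ℂ J]

/-- The canonical star-homomorphism `J⁺ → ℂ`, `x + λ ↦ λ`, on the unitization of `J`. -/
def scalarPart : Unitization ℂ J →⋆ₐ[ℂ] ℂ where
  toAlgHom := Unitization.fstHom ℂ J
  map_star' := fun x => Unitization.fst_star x

/-- `K₀(J) = ker (K₀(J⁺) → K₀(ℂ))`. -/
def KZero : AddSubgroup (KZeroUnital (Unitization ℂ J)) :=
  (KZeroUnital.map (scalarPart J)).ker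

variable {J}

/-- The element `[p] - [q]` of `K₀(J)` given by two projections `p`, `q` in matrix algebras
over `J⁺` whose scalar parts have the same class in `K₀(ℂ)`. -/
def KZero.diff (p q : ProjMat (Unitization ℂ J))
    (h : KZeroUnital.mk (p.map (scalarPart J)) = KZeroUnital.mk (q.map (scalarPart J))) :
    KZero J :=
  ⟨KZeroUnital.mk p - KZeroUnital.mk q, by
    simp [KZero, AddMonoidHom.mem_ker, KZeroUnital.map_mk, h]⟩

end NonUnital

/-! ### Traces on von Neumann algebras and the trace-compact operators -/

section Trace

variable {H : Type*} [NormedAddCommGroup H] [InnerProductSpace ℂ H] [CompleteSpace H]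

/-- `τ` is a faithful normal semifinite trace on the positive cone of the von Neumann algebra `N`,
with values in `[0, ∞]`. Only the values of `τ` at positive elements of `N` matter.
The order on operators is the usual one: `x ≤ y` iff `y - x` is positive. -/
structure IsFNSTrace (N : VonNeumannAlgebra H) (τ : (H →L[ℂ] H) → ℝ≥0∞) : Prop where
  add : ∀ x ∈ N, ∀ y ∈ N, 0 ≤ x → 0 ≤ y → τ (x + y) = τ x + τ y
  smul : ∀ c : ℝ≥0, ∀ x ∈ N, 0 ≤ x → τ ((c : ℂ) • x) = c * τ x
  trace : ∀ x ∈ N, τ (star x * x) = τ (x * star x)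
  faithful : ∀ x ∈ N, 0 ≤ x → τ x = 0 → x = 0
  normal : ∀ (S : Set (H →L[ℂ] H)) (x : H →L[ℂ] H), S.Nonempty → DirectedOn (· ≤ ·) S →
    (∀ s ∈ S, s ∈ N ∧ 0 ≤ s) → x ∈ N → IsLUB S x → τ x = ⨆ s ∈ S, τ s
  semifinite : ∀ x ∈ N, 0 ≤ x → x ≠ 0 → ∃ y ∈ N, 0 ≤ y ∧ y ≠ 0 ∧ y ≤ x ∧ τ y < ∞

/-- The elements `a p b` with `a`, `b` in `N` and `p` a projection in `N` of finite trace. -/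
def finiteGenerators (N : VonNeumannAlgebra H) (τ : (H →L[ℂ] H) → ℝ≥0∞) : Set (H →L[ℂ] H) :=
  {x | ∃ a ∈ N, ∃ b ∈ N, ∃ p ∈ N, IsStarProjection p ∧ τ p < ∞ ∧ x = a * p * b}

/-- The ideal `ℱ_N` of `N` generated by the projections of finite trace, that is the linear span of
all `a p b` with `a`, `b` in `N` and `p` a projection in `N` of finite trace. -/
def finiteIdeal (N : VonNeumannAlgebra H) (τ : (H →L[ℂ] H) → ℝ≥0∞) :
    NonUnitalStarSubalgebra ℂ (H →L[ℂ] H) where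
  toSubmodule := Submodule.span ℂ (finiteGenerators N τ)
  mul_mem' := by
    intro x y hx hy
    change x ∈ Submodule.span ℂ _ at hx
    change y ∈ Submodule.span ℂ _ at hy
    change x * y ∈ Submodule.span ℂ _
    have h := Submodule.mul_mem_mul hx hy
    rw [Submodule.span_mul_span] at h
    refine Submodule.span_mono ?_ h
    rintro _ ⟨_, ⟨a, ha, b, hb, p, hp, hp1, hp2, rfl⟩, _, ⟨c, hc, d, hd, q, hq, _, _, rfl⟩, rfl⟩
    exact ⟨a, ha, b * (c * q * d), mul_mem hb (mul_mem (mul_mem hc hq) hd), p, hp, hp1, hp2,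
      by simp only [mul_assoc]⟩
  star_mem' := by
    intro x hx
    change x ∈ Submodule.span ℂ _ at hx
    change star x ∈ Submodule.span ℂ _
    induction hx using Submodule.span_induction with
    | mem x hx =>
      obtain ⟨a, ha, b, hb, p, hp, hp1, hp2, rfl⟩ := hx
      refine Submodule.subset_span ⟨star b, star_mem hb, star a, star_mem ha, p, hp, hp1, hp2, ?_⟩
      simp only [star_mul, hp1.isSelfAdjoint.star_eq, mul_assoc]
    | zero => simp
    | add x y _ _ hx hy => rw [star_add]; exact add_mem hx hy
    | smul c x _ hx => rw [star_smul]; exact Submodule.smul_mem _ _ hx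

/-- The `τ`-compact operators `𝒦_N`: the norm closure of `ℱ_N`. -/
def tauCompact (N : VonNeumannAlgebra H) (τ : (H →L[ℂ] H) → ℝ≥0∞) :
    NonUnitalStarSubalgebra ℂ (H →L[ℂ] H) :=
  (finiteIdeal N τ).topologicalClosure

/-- The canonical extension of `τ` to a complex-valued function:
`τ(x) = τ((Re x)₊) - τ((Re x)₋) + i (τ((Im x)₊) - τ((Im x)₋))`. It is used on `ℱ_N` only, where
the four traces are finite and the extension is linear. -/
def linTrace (τ : (H →L[ℂ] H) → ℝ≥0∞) (x : H →L[ℂ] H) : ℂ :=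
  (((τ (realPart x : H →L[ℂ] H)⁺).toReal - (τ (realPart x : H →L[ℂ] H)⁻).toReal : ℝ) : ℂ) +
  (((τ (imaginaryPart x : H →L[ℂ] H)⁺).toReal - (τ (imaginaryPart x : H →L[ℂ] H)⁻).toReal : ℝ) : ℂ)
    * Complex.I

/-- `τ_n = τ ⊗ Tr` on `M_n(ℱ_N)`. -/
def matTrace (τ : (H →L[ℂ] H) → ℝ≥0∞) {n : ℕ} (x : Matrix (Fin n) (Fin n) (H →L[ℂ] H)) : ℂ :=
  ∑ i, linTrace τ (x i i)

end Trace

end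

/-! The theorem is an instance of a general fact about a C*-algebra `K` and a dense two-sided
star-ideal `F`: up to equivalence, `F + ℂ` already contains all projections over the unitization
`K⁺`, so a tracial functional on `F` induces a homomorphism on `K₀(K)`. `IsDenseTraceIdeal` records
what is needed.

Three perturbation arguments carry this. A projection over `K⁺` is approximated by a self-adjoint
matrix `x` over `F + ℂ` with the same scalar part. Functional calculus moves `x` to a nearby
projection `x + (x² - x)k`, and since `x² - x` is over the ideal `F`, this projection is still over
`F + ℂ` (`exists_overF_equiv`). An equivalence over `K⁺` between idempotents over `F + ℂ` can be
replaced by one over `F + ℂ`, so their traces agree (`matSndTrace_eq_of_equiv`). A projection over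
`K` itself has the form `p = (p x p) u⁻¹` with `x` over `F`, so it is over `F`
(`inF_of_isIdempotentElem`). The first argument gives uniqueness, the first two together give
existence, and the third gives part (1).

It remains to see that the extended trace on `ℱ_N` is linear and tracial. The delicate point is that
the formula through positive and negative parts is additive. If `x ≤ u` with `u ≥ 0`, then `x⁺ ≤ u`
may fail, but `τ(x⁺) ≤ τ(u)` holds by normality (`posPart_le`). So both parts of a difference of
finite-trace positive elements have finite trace, and additivity on the positive cone applies.
Traciality follows from `τ(z z*) = τ(z* z)` by polarization. -/

noncomputable section

/-! ### Perturbation of projections in a C*-algebra. -/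

section CStar

variable {B : Type*} [CStarAlgebra B]

/-- The inverse square root of `1 + w` for a self-adjoint `w` of norm less than one. -/
theorem exists_invSqrt_one_add {w : B} (hw : IsSelfAdjoint w) (h : ‖w‖ < 1) :
    ∃ r c k : B, IsSelfAdjoint r ∧ r * r * (1 + w) = 1 ∧ r = 1 + w * k ∧ r * c = 1 ∧
      ‖c - 1‖ ≤ ‖w‖ ∧ ∀ b, Commute w b → Commute r b := by
  have hspec : ∀ t ∈ spectrum ℝ w, |t| ≤ ‖w‖ := by
    intro t ht
    have := norm_apply_le_norm_cfc (fun t : ℝ => t) w ht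
    rwa [cfc_id' ℝ w, Real.norm_eq_abs] at this
  have hpos : ∀ t ∈ spectrum ℝ w, 0 < 1 + t := by
    intro t ht
    have := (abs_le.1 (hspec t ht)).1
    linarith
  have hsq : ∀ t ∈ spectrum ℝ w, 0 < √(1 + t) := fun t ht => Real.sqrt_pos.2 (hpos t ht)
  have hc0 : ContinuousOn (fun t : ℝ => √(1 + t)) (spectrum ℝ w) := by fun_prop
  have hc1 : ContinuousOn (fun t : ℝ => (√(1 + t))⁻¹) (spectrum ℝ w) :=
    hc0.inv₀ fun t ht => (hsq t ht).ne'
  have hc2 : ContinuousOn (fun t : ℝ => -(√(1 + t) * (1 + √(1 + t)))⁻¹) (spectrum ℝ w) :=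
    ((hc0.mul (continuousOn_const.add hc0)).inv₀ fun t ht => by
      have := hsq t ht; exact (mul_pos this (add_pos one_pos this)).ne').neg
  have h1w : 1 + w = cfc (fun t : ℝ => 1 + t) w := by
    rw [cfc_const_add (1 : ℝ) (fun t => t) w, cfc_id' ℝ w, map_one]
  -- With `s = √(1 + t)`, the function for `k` comes from `1/s - 1 = (1 - s²)/(s(1 + s)) = -t/(s(1 +
  -- s))`.
  refine ⟨cfc (fun t : ℝ => (√(1 + t))⁻¹) w, cfc (fun t : ℝ => √(1 + t)) w,
    cfc (fun t : ℝ => -(√(1 + t) * (1 + √(1 + t)))⁻¹) w, IsSelfAdjoint.cfc, ?_, ?_, ?_, ?_, ?_⟩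
  · have hc3 : ContinuousOn (fun t : ℝ => (√(1 + t))⁻¹ * (√(1 + t))⁻¹) (spectrum ℝ w) :=
      hc1.mul hc1
    rw [h1w, ← cfc_mul _ _ w hc1 hc1, ← cfc_mul _ _ w hc3 (by fun_prop), ← cfc_one ℝ w]
    refine cfc_congr fun t ht => ?_
    have h1 := hsq t ht
    have h2 : √(1 + t) * √(1 + t) = 1 + t := Real.mul_self_sqrt (hpos t ht).le
    simp only [Pi.one_apply]
    rw [← mul_inv, h2, inv_mul_cancel₀ (hpos t ht).ne']
  · have e : w * cfc (fun t : ℝ => -(√(1 + t) * (1 + √(1 + t)))⁻¹) w =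
        cfc (fun t : ℝ => t * -(√(1 + t) * (1 + √(1 + t)))⁻¹) w := by
      rw [cfc_mul _ _ w (by fun_prop) hc2, cfc_id' ℝ w]
    have hc3 : ContinuousOn (fun t : ℝ => t * -(√(1 + t) * (1 + √(1 + t)))⁻¹) (spectrum ℝ w) :=
      continuousOn_id.mul hc2
    rw [e, ← map_one (algebraMap ℝ B), ← cfc_const_add (1 : ℝ) _ w hc3]
    refine cfc_congr fun t ht => ?_
    have h1 := hsq t ht
    have h2 : √(1 + t) * √(1 + t) = 1 + t := Real.mul_self_sqrt (hpos t ht).le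
    have h3 : t = (√(1 + t) - 1) * (1 + √(1 + t)) := by ring_nf; rw [pow_two, h2]; ring
    have h4 : 1 + √(1 + t) ≠ 0 := by positivity
    generalize √(1 + t) = s at *
    rw [h3]
    field_simp
    ring
  · rw [← cfc_mul _ _ w hc1 hc0, ← cfc_one ℝ w]
    exact cfc_congr fun t ht => inv_mul_cancel₀ (hsq t ht).ne'
  · rw [← cfc_one ℝ w, ← cfc_sub _ _ w hc0 (by fun_prop)]
    refine norm_cfc_le (norm_nonneg w) fun t ht => ?_
    refine le_trans ?_ (hspec t ht)
    have h2 : √(1 + t) * √(1 + t) = 1 + t := Real.mul_self_sqrt (hpos t ht).le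
    have h3 : t = (√(1 + t) - 1) * (1 + √(1 + t)) := by ring_nf; rw [pow_two, h2]; ring
    have h1 := hsq t ht
    simp only [Pi.one_apply, Real.norm_eq_abs]
    conv_rhs => rw [h3, abs_mul]
    refine le_mul_of_one_le_right (abs_nonneg _) ?_
    rw [abs_of_pos (by positivity)]
    linarith
  · exact fun b hb => hb.cfc_real _

/-- Projections at distance less than one are Murray-von Neumann equivalent. -/
theorem exists_partialIsometry_of_norm_sub_lt_one {p e : B} (hp : IsStarProjection p)
    (he : IsStarProjection e) (h : ‖p - e‖ < 1) :
    ∃ v : B, star v * v = p ∧ v * star v = e := by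
  have hpp : p * p = p := hp.isIdempotentElem
  have hee : e * e = e := he.isIdempotentElem
  have hps : star p = p := hp.isSelfAdjoint
  have hes : star e = e := he.isSelfAdjoint
  have hnp : ‖p‖ ≤ 1 := hp.norm_le
  have hne : ‖e‖ ≤ 1 := he.norm_le
  have bound : ∀ a b : B, ‖a‖ ≤ 1 → ‖b‖ < 1 → ‖a * b * a‖ < 1 := by
    intro a b ha hb
    calc ‖a * b * a‖ ≤ ‖a‖ * ‖b‖ * ‖a‖ := (norm_mul_le _ _).trans (by gcongr; exact norm_mul_le _ _)
      _ ≤ 1 * ‖b‖ * 1 := by gcongr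
      _ < 1 := by linarith
  have h' : ‖e - p‖ < 1 := by rwa [norm_sub_rev]
  -- Here `p e p = p(1 + w)`, so `v = e p r` below is `e p` times the inverse square root of `p e p`
  -- in the corner of `p`: the polar part of `e p`.
  set w : B := p * (e - p) * p with hwdef
  have hw : IsSelfAdjoint w := by
    simp [hwdef, IsSelfAdjoint, hps, hes, mul_assoc]
  have hpw : p * w = w := by simp only [hwdef, ← mul_assoc, hpp]
  have hwp : w * p = w := by simp only [hwdef, mul_assoc, hpp]
  have hpep : p * e * p = p * (1 + w) := by
    rw [mul_add, mul_one, hpw, hwdef]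
    simp only [mul_sub, sub_mul, hpp]
    abel
  obtain ⟨r, c, -, hr, hr1, -, hrc, -, hcomm⟩ := exists_invSqrt_one_add hw (bound p _ hnp h')
  have hrp : r * p = p * r := (hcomm p (show w * p = p * w by rw [hpw, hwp])).eq
  have hrw : r * (1 + w) = (1 + w) * r :=
    (hcomm (1 + w) ((Commute.one_right w).add_right (Commute.refl w))).eq
  have hcr : c * r = 1 := by
    have hr2 : r * (1 + w) * r = 1 := by rw [mul_assoc, ← hrw, ← mul_assoc, hr1]
    have : c = r * (1 + w) := by
      calc c = 1 * c := (one_mul c).symm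
        _ = r * (1 + w) * (r * c) := by rw [← mul_assoc, hr2]
        _ = _ := by rw [hrc, mul_one]
    rw [this, hr2]
  set v : B := e * p * r with hv
  have hsv : star v = r * p * e := by
    simp [hv, hr.star_eq, hps, hes, mul_assoc]
  have hvv : star v * v = p := by
    rw [hsv, hv]
    calc r * p * e * (e * p * r) = r * (p * (e * e) * p) * r := by simp only [mul_assoc]
      _ = p * (r * r * (1 + w)) := by
        rw [hee, hpep, ← mul_assoc, hrp, mul_assoc r r, hrw, mul_assoc p,
          mul_assoc p, ← mul_assoc r, hrw]
      _ = p := by rw [hr1, mul_one]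
  refine ⟨v, hvv, ?_⟩
  set f := v * star v with hf
  have hvp : v * p = v := by rw [hv, mul_assoc, hrp, ← mul_assoc, mul_assoc e, hpp]
  have hfv : f * v = v := by rw [hf, mul_assoc, hvv, hvp]
  have hep : e * p = v * c := by
    rw [hv, mul_assoc (e * p), hrc, mul_one]
  have hfp : f * (e * p) = e * p := by rw [hep, ← mul_assoc, hfv]
  have hev : e * v = v := by rw [hv, ← mul_assoc, ← mul_assoc, hee]
  have hve : star v * e = star v := by rw [hsv, mul_assoc, hee]
  have hfe : f * e = f := by rw [hf, mul_assoc, hve]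
  -- `e - f` kills the invertible element `1 - e + e p e`
  have hu : ‖e * (p - e) * e‖ < 1 := bound e _ hne h
  have hz : (e - f) * (1 + e * (p - e) * e) = 0 := by
    have h0 : (e - f) * (e * p) = 0 := by rw [sub_mul, hfp, ← mul_assoc, hee, sub_self]
    have h1 : (e - f) * e = e - f := by rw [sub_mul, hee, hfe]
    have : e * (p - e) * e = e * p * e - e := by simp only [mul_sub, sub_mul, hee]
    rw [this, mul_add, mul_sub, ← mul_assoc (e - f) (e * p) e, h0, h1]
    simp
  have hunit : IsUnit (1 + e * (p - e) * e) := by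
    have := isUnit_one_sub_of_norm_lt_one (x := -(e * (p - e) * e)) (by rwa [norm_neg])
    simpa using this
  have := (hunit.mul_left_eq_zero).1 hz
  exact (sub_eq_zero.1 this).symm

/-- Near a self-adjoint element close to a projection there is a projection. -/
theorem exists_isStarProjection_near {p x : B} (hp : IsStarProjection p) (hx : IsSelfAdjoint x)
    (h : ‖x - p‖ < 1 / 10) :
    ∃ e k : B, IsStarProjection e ∧ ‖p - e‖ < 1 ∧ e = x + (x * x - x) * k := by
  have hpp : p * p = p := hp.isIdempotentElem
  have hps : star p = p := hp.isSelfAdjoint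
  -- Projections correspond to symmetries `2p - 1`. Here `S` is close to the symmetry `P`, and `E =
  -- S (S²)^(-1/2)` is an exact symmetry close to `S`.
  set P : B := 2 * p - 1 with hP
  set S : B := 2 * x - 1 with hS
  have two_comm : ∀ b : B, b * 2 = 2 * b := fun b => (Commute.ofNat_right b 2).eq
  have hSsa : star S = S := by simp [hS, hx.star_eq, two_comm]
  have hPsa : star P = P := by simp [hP, hps, two_comm]
  have hPP : P * P = 1 := by
    have : P * P = (4 : ℤ) • (p * p) - (4 : ℤ) • p + 1 := by rw [hP]; noncomm_ring
    rw [this, hpp]; abel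
  have selfadj_unit : ∀ E : B, star E = E → E * E = 1 → ‖E‖ ≤ 1 := by
    intro E h1 h2
    have h3 : ‖E‖ * ‖E‖ = ‖(1 : B)‖ := by rw [← CStarRing.norm_star_mul_self, h1, h2]
    rcases subsingleton_or_nontrivial B with hs | hs
    · rw [Subsingleton.elim E 0]; simp
    · rw [CStarRing.norm_one] at h3
      nlinarith [norm_nonneg E]
  have hPn : ‖P‖ ≤ 1 := selfadj_unit P hPsa hPP
  have hSP : ‖S - P‖ ≤ 2 * ‖x - p‖ := by
    have : S - P = (2 : ℂ) • (x - p) := by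
      rw [hS, hP, two_smul]; noncomm_ring
    rw [this, norm_smul]; simp
  set w : B := (4 : ℂ) • (x * x - x) with hw
  have hSw : S * S = 1 + w := by
    have : (4 : ℂ) • (x * x - x) = 4 * (x * x - x) := by
      rw [Algebra.smul_def, map_ofNat]
    rw [hS, hw, this]
    noncomm_ring
  have hwsa : IsSelfAdjoint w := by
    have : w = S * S - 1 := by rw [hSw]; abel
    rw [this]; simp [IsSelfAdjoint, hSsa]
  -- The constant is `(2/10)(12/10) + 2/10`. Later `‖P - E‖ < 1` follows from `44/100 + 2/10 < 1`.
  have hwn : ‖w‖ ≤ 44 / 100 := by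
    have h1 : w = (S - P) * S + P * (S - P) := by
      have : w = S * S - P * P := by rw [hSw, hPP]; abel
      rw [this]; noncomm_ring
    have h2 : ‖S‖ ≤ 12 / 10 := by
      have : S = (S - P) + P := by abel
      rw [this]; exact (norm_add_le _ _).trans (by linarith)
    rw [h1]
    calc ‖(S - P) * S + P * (S - P)‖ ≤ ‖S - P‖ * ‖S‖ + ‖P‖ * ‖S - P‖ :=
          (norm_add_le _ _).trans (add_le_add (norm_mul_le _ _) (norm_mul_le _ _))
      _ ≤ (2 / 10) * (12 / 10) + 1 * (2 / 10) := by gcongr <;> linarith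
      _ ≤ _ := by norm_num
  obtain ⟨r, c, k, hr, hr1, hrk, hrc, hcn, hcomm⟩ :=
    exists_invSqrt_one_add hwsa (hwn.trans_lt (by norm_num))
  have hwS : w * S = S * w := by
    have : w = S * S - 1 := by rw [hSw]; abel
    rw [this]; noncomm_ring
  have hrS : r * S = S * r := (hcomm S hwS).eq
  set E : B := S * r with hE
  have hEsa : star E = E := by rw [hE, star_mul, hr.star_eq, hSsa, hrS]
  have hEE : E * E = 1 := by
    have hrw : r * (1 + w) = (1 + w) * r :=
      (hcomm (1 + w) ((Commute.one_right w).add_right (Commute.refl w))).eq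
    calc S * r * (S * r) = r * S * (S * r) := by rw [hrS]
      _ = r * (S * S * r) := by simp only [mul_assoc]
      _ = 1 := by rw [hSw, ← hrw, ← mul_assoc, hr1]
  have hEn : ‖E‖ ≤ 1 := selfadj_unit E hEsa hEE
  have hES : ‖E - S‖ ≤ ‖w‖ := by
    have : E - S = -(E * (c - 1)) := by
      rw [mul_sub, hE, mul_assoc, hrc]; simp
    rw [this, norm_neg]
    calc ‖E * (c - 1)‖ ≤ ‖E‖ * ‖c - 1‖ := norm_mul_le _ _
      _ ≤ 1 * ‖w‖ := by gcongr
      _ = _ := one_mul _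
  have hEP : ‖P - E‖ < 1 := by
    have : P - E = -((E - S) + (S - P)) := by abel
    rw [this, norm_neg]
    exact (norm_add_le _ _).trans_lt (by linarith)
  refine ⟨(1 / 2 : ℂ) • (1 + E), (2 : ℂ) • (k * S), ⟨?_, ?_⟩, ?_, ?_⟩
  · rw [IsIdempotentElem, smul_mul_smul_comm]
    have : (1 + E) * (1 + E) = (2 : ℂ) • (1 + E) := by
      rw [two_smul]; simp only [mul_add, add_mul, one_mul, mul_one, hEE]; abel
    rw [this, smul_smul]; norm_num
  · simp [IsSelfAdjoint, hEsa]
  · have : p - (1 / 2 : ℂ) • (1 + E) = (1 / 2 : ℂ) • (P - E) := by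
      have h2 : p = (1 / 2 : ℂ) • (2 * p) := by
        rw [show (2 * p : B) = (2 : ℂ) • p by rw [two_smul, two_mul], smul_smul]; norm_num
      conv_lhs => rw [h2]
      rw [← smul_sub, hP]; congr 1; abel
    rw [this, norm_smul]
    norm_num
    linarith
  -- Since `E = S + w k S` and `w = 4(x² - x)`, halving gives the correction `(x² - x)(2 k S)`. Any
  -- ideal containing `x² - x` thus contains it, wherever `k` lies.
  · have hSx : (1 / 2 : ℂ) • (1 + S) = x := by
      rw [hS, show (1 + (2 * x - 1) : B) = (2 : ℂ) • x by rw [two_smul]; noncomm_ring, smul_smul]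
      norm_num
    have : E = S + w * k * S := by
      change S * r = _
      rw [← (hcomm S hwS).eq, hrk, add_mul, one_mul]
    rw [this, ← add_assoc, smul_add, hSx, hw]
    congr 1
    rw [mul_smul_comm, smul_mul_assoc, smul_mul_assoc, smul_smul, mul_assoc]
    norm_num

end CStar

/-! ### Dense trace ideals and matrices over `F + ℂ`. -/

section DenseTraceIdeal

/-- `F` is a dense star-ideal of `K`, and `φ` is a tracial linear functional on `F` which is real
on self-adjoint elements. -/
structure IsDenseTraceIdeal {K : Type*} [NonUnitalCStarAlgebra K] (F : Submodule ℂ K)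
    (φ : K → ℂ) : Prop where
  dense : Dense (F : Set K)
  mul_mem_left : ∀ a, ∀ x ∈ F, a * x ∈ F
  mul_mem_right : ∀ a, ∀ x ∈ F, x * a ∈ F
  star_mem : ∀ x ∈ F, star x ∈ F
  map_add : ∀ x ∈ F, ∀ y ∈ F, φ (x + y) = φ x + φ y
  map_smul : ∀ (c : ℂ), ∀ x ∈ F, φ (c • x) = c * φ x
  map_mul_comm : ∀ x ∈ F, ∀ y ∈ F, φ (x * y) = φ (y * x)
  im_eq_zero : ∀ x ∈ F, IsSelfAdjoint x → (φ x).im = 0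

variable {K : Type*} [NonUnitalCStarAlgebra K]

/-- The matrix `M` over the unitization of `K` has entries in `F + ℂ`. -/
def OverF (F : Submodule ℂ K) {m n : Type*} (M : Matrix m n (Unitization ℂ K)) : Prop :=
  ∀ i j, (M i j).snd ∈ F

/-- The matrix `M` over the unitization of `K` has entries in `F`. -/
def InF (F : Submodule ℂ K) {m n : Type*} (M : Matrix m n (Unitization ℂ K)) : Prop :=
  ∀ i j, (M i j).fst = 0 ∧ (M i j).snd ∈ F

/-- The matrix of scalar parts. -/
abbrev scalarMat {m n : Type*} (M : Matrix m n (Unitization ℂ K)) : Matrix m n ℂ :=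
  M.map (Unitization.fstHom ℂ K)

/-- The trace of the part of a square matrix lying in `K`. -/
def matSndTrace (φ : K → ℂ) {n : Type*} [Fintype n] (M : Matrix n n (Unitization ℂ K)) : ℂ :=
  ∑ i, φ (M i i).snd

variable {F : Submodule ℂ K} {φ : K → ℂ} {l m n : Type*}

theorem scalarMat_mul [Fintype m] (M : Matrix l m (Unitization ℂ K))
    (N : Matrix m n (Unitization ℂ K)) : scalarMat (M * N) = scalarMat M * scalarMat N :=
  Matrix.map_mul (f := (Unitization.fstHom ℂ K : Unitization ℂ K →+* ℂ))

theorem scalarMat_sub (M N : Matrix m n (Unitization ℂ K)) :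
    scalarMat (M - N) = scalarMat M - scalarMat N :=
  Matrix.map_sub _ (map_sub (Unitization.fstHom ℂ K)) M N

theorem scalarMat_add (M N : Matrix m n (Unitization ℂ K)) :
    scalarMat (M + N) = scalarMat M + scalarMat N :=
  Matrix.map_add _ (map_add (Unitization.fstHom ℂ K)) M N

theorem scalarMat_one [DecidableEq n] :
    scalarMat (1 : Matrix n n (Unitization ℂ K)) = 1 :=
  Matrix.map_one _ (map_zero (Unitization.fstHom ℂ K)) (map_one (Unitization.fstHom ℂ K))

theorem OverF.inF {M : Matrix m n (Unitization ℂ K)} (hM : OverF F M) (h : scalarMat M = 0) :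
    InF F M := fun i j => ⟨congr_fun (congr_fun h i) j, hM i j⟩

theorem InF.overF {M : Matrix m n (Unitization ℂ K)} (hM : InF F M) : OverF F M :=
  fun i j => (hM i j).2

theorem OverF.add {M N : Matrix m n (Unitization ℂ K)} (hM : OverF F M) (hN : OverF F N) :
    OverF F (M + N) := fun i j => F.add_mem (hM i j) (hN i j)

theorem OverF.sub {M N : Matrix m n (Unitization ℂ K)} (hM : OverF F M) (hN : OverF F N) :
    OverF F (M - N) := fun i j => F.sub_mem (hM i j) (hN i j)

theorem OverF.smul {M : Matrix m n (Unitization ℂ K)} (c : ℂ) (hM : OverF F M) :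
    OverF F (c • M) := fun i j => F.smul_mem c (hM i j)

theorem OverF.one [DecidableEq n] : OverF F (1 : Matrix n n (Unitization ℂ K)) := by
  intro i j
  rw [Matrix.one_apply]
  split_ifs <;> simp

theorem snd_sum {ι : Type*} (s : Finset ι) (f : ι → Unitization ℂ K) :
    (∑ i ∈ s, f i).snd = ∑ i ∈ s, (f i).snd :=
  map_sum (Unitization.sndHom ℂ ℂ K) f s

theorem fst_sum {ι : Type*} (s : Finset ι) (f : ι → Unitization ℂ K) :
    (∑ i ∈ s, f i).fst = ∑ i ∈ s, (f i).fst :=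
  map_sum (Unitization.fstHom ℂ K) f s

namespace IsDenseTraceIdeal

variable (h : IsDenseTraceIdeal F φ)
include h

theorem overF_mul [Fintype m] {M : Matrix l m (Unitization ℂ K)}
    {N : Matrix m n (Unitization ℂ K)} (hM : OverF F M) (hN : OverF F N) : OverF F (M * N) := by
  intro i j
  rw [Matrix.mul_apply, snd_sum]
  refine F.sum_mem fun k _ => ?_
  rw [Unitization.snd_mul]
  exact F.add_mem (F.add_mem (F.smul_mem _ (hN k j)) (F.smul_mem _ (hM i k)))
    (h.mul_mem_left _ _ (hN k j))

theorem overF_conjTranspose {M : Matrix m n (Unitization ℂ K)} (hM : OverF F M) :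
    OverF F M.conjTranspose := by
  intro i j
  rw [Matrix.conjTranspose_apply, Unitization.snd_star]
  exact h.star_mem _ (hM j i)

theorem inF_mul_right [Fintype m] {M : Matrix l m (Unitization ℂ K)}
    (N : Matrix m n (Unitization ℂ K)) (hM : InF F M) : InF F (M * N) := by
  intro i j
  rw [Matrix.mul_apply, snd_sum, fst_sum]
  refine ⟨Finset.sum_eq_zero fun k _ => ?_, F.sum_mem fun k _ => ?_⟩
  · simp [(hM i k).1]
  · rw [Unitization.snd_mul, (hM i k).1, zero_smul, zero_add]
    exact F.add_mem (F.smul_mem _ (hM i k).2) (h.mul_mem_right _ _ (hM i k).2)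

theorem inF_mul_left [Fintype m] (M : Matrix l m (Unitization ℂ K))
    {N : Matrix m n (Unitization ℂ K)} (hN : InF F N) : InF F (M * N) := by
  intro i j
  rw [Matrix.mul_apply, snd_sum, fst_sum]
  refine ⟨Finset.sum_eq_zero fun k _ => ?_, F.sum_mem fun k _ => ?_⟩
  · simp [(hN k j).1]
  · rw [Unitization.snd_mul, (hN k j).1, zero_smul, add_zero]
    exact F.add_mem (F.smul_mem _ (hN k j).2) (h.mul_mem_left _ _ (hN k j).2)

theorem map_zero : φ 0 = 0 := by
  have := h.map_add 0 F.zero_mem 0 F.zero_mem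
  simpa using this

theorem map_sum {ι : Type*} (s : Finset ι) (f : ι → K) (hf : ∀ i ∈ s, f i ∈ F) :
    φ (∑ i ∈ s, f i) = ∑ i ∈ s, φ (f i) := by
  classical
  induction s using Finset.induction_on with
  | empty => simpa using h.map_zero
  | insert a s ha ih =>
    rw [Finset.sum_insert ha, Finset.sum_insert ha, h.map_add _ (hf a (by simp)) _
      (F.sum_mem fun i hi => hf i (by simp [hi])), ih fun i hi => hf i (by simp [hi])]

/-- The `K`-part of `(λ + x)(μ + y)` is `λy + μx + xy`. Swapping the factors exchanges the first two
terms, and `φ` is tracial on the third. -/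
theorem matSndTrace_mul_comm [Fintype m] [Fintype n] {M : Matrix m n (Unitization ℂ K)}
    {N : Matrix n m (Unitization ℂ K)} (hM : OverF F M) (hN : OverF F N) :
    matSndTrace φ (M * N) = matSndTrace φ (N * M) := by
  have key : ∀ i j, φ (M i j * N j i).snd = φ (N j i * M i j).snd := by
    intro i j
    have hx := hM i j
    have hy := hN j i
    rw [Unitization.snd_mul, Unitization.snd_mul,
      h.map_add _ (F.add_mem (F.smul_mem _ hy) (F.smul_mem _ hx)) _ (h.mul_mem_left _ _ hy),
      h.map_add _ (F.add_mem (F.smul_mem _ hx) (F.smul_mem _ hy)) _ (h.mul_mem_left _ _ hx),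
      h.map_mul_comm _ hx _ hy, add_comm ((M i j).fst • _)]
  have mem : ∀ a b : Unitization ℂ K, a.snd ∈ F → b.snd ∈ F → (a * b).snd ∈ F := by
    intro a b ha hb
    rw [Unitization.snd_mul]
    exact F.add_mem (F.add_mem (F.smul_mem _ hb) (F.smul_mem _ ha)) (h.mul_mem_left _ _ hb)
  simp only [matSndTrace, Matrix.mul_apply, snd_sum]
  have e1 : ∀ i, φ (∑ j, (M i j * N j i).snd) = ∑ j, φ (M i j * N j i).snd :=
    fun i => h.map_sum _ _ fun j _ => mem _ _ (hM i j) (hN j i)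
  have e2 : ∀ j, φ (∑ i, (N j i * M i j).snd) = ∑ i, φ (N j i * M i j).snd :=
    fun j => h.map_sum _ _ fun i _ => mem _ _ (hN j i) (hM i j)
  simp only [e1, e2]
  rw [Finset.sum_comm]
  exact Finset.sum_congr rfl fun i _ => Finset.sum_congr rfl fun j _ => key j i

/-- Matrices over `F + ℂ` with prescribed scalar part are dense. -/
theorem mem_closure_overF [Finite m] [Finite n] (M : Matrix m n (Unitization ℂ K)) :
    M ∈ closure {X | OverF F X ∧ scalarMat X = scalarMat M} := by
  let g : Matrix m n K → Matrix m n (Unitization ℂ K) := fun k =>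
    Matrix.of fun i j => Unitization.inl (M i j).fst + Unitization.inr (k i j)
  have hinr : Continuous (Unitization.inr : K → Unitization ℂ K) :=
    (Unitization.isometry_inr (𝕜 := ℂ) (A := K)).continuous
  have hg : Continuous g := by
    refine continuous_matrix fun i j => ?_
    exact continuous_const.add (hinr.comp (continuous_id.matrix_elem i j))
  have hd : Dense {k : Matrix m n K | ∀ i j, k i j ∈ F} := by
    have h1 : Dense (Set.pi Set.univ fun _ : m => Set.pi Set.univ fun _ : n => (F : Set K)) :=
      dense_pi _ fun _ _ => dense_pi _ fun _ _ => h.dense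
    refine h1.mono fun k hk => ?_
    have hk' := fun i j => Set.mem_pi.1 (Set.mem_pi.1 hk i trivial) j trivial
    exact hk'
  have hM : g (Matrix.of fun i j => (M i j).snd) = M := by
    refine Matrix.ext fun i j => ?_
    exact Unitization.inl_fst_add_inr_snd_eq _
  have := image_closure_subset_closure_image hg
    ⟨_, hd (Matrix.of fun i j => (M i j).snd), hM⟩
  refine closure_mono ?_ this
  rintro _ ⟨k, hk, rfl⟩
  refine ⟨fun i j => ?_, ?_⟩
  · simpa [g] using hk i j
  · ext i j
    simp [g]

end IsDenseTraceIdeal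

/-- The entrywise topology is also that of the C*-norm on `CStarMatrix`, and units are open in a
complete normed ring. The spectral order only serves to make that norm available. -/
theorem isOpen_isUnit_matrix [Fintype n] [DecidableEq n] :
    IsOpen {M : Matrix n n (Unitization ℂ K) | IsUnit M} := by
  let := CStarAlgebra.spectralOrder (Unitization ℂ K)
  have := CStarAlgebra.spectralOrderedRing (Unitization ℂ K)
  exact Units.isOpen (R := CStarMatrix n n (Unitization ℂ K))

end DenseTraceIdeal

/-! ### Moving projections and equivalences into `F + ℂ`. -/

section Projections

variable {K : Type*} [NonUnitalCStarAlgebra K] {F : Submodule ℂ K} {φ : K → ℂ}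

namespace IsDenseTraceIdeal

variable (h : IsDenseTraceIdeal F φ)
include h

/-- A unit which is congruent to `1` modulo the matrices over `F` has its inverse over `F + ℂ`. -/
theorem overF_inverse {n : Type*} [Fintype n] [DecidableEq n]
    {u r : Matrix n n (Unitization ℂ K)} (hu : OverF F u) (hs : scalarMat u = 1)
    (hur : u * r = 1) : OverF F r := by
  have h1 : InF F (1 - u) := (OverF.one.sub hu).inF (by
    rw [scalarMat_sub, scalarMat_one, hs, sub_self])
  -- A priori `r` is only over `K⁺`, but `1 - u` is over the ideal `F` and absorbs it.
  have h2 : r = 1 + (1 - u) * r := by rw [sub_mul, hur, one_mul]; abel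
  rw [h2]
  exact OverF.one.add (h.inF_mul_right r h1).overF

/-- Algebraically equivalent idempotents over `F + ℂ` have the same trace, even if the
equivalence is only implemented over the unitization of `K`. -/
theorem matSndTrace_eq_of_equiv {m n : Type*} [Fintype m] [DecidableEq m] [Fintype n]
    [DecidableEq n] {e : Matrix m m (Unitization ℂ K)} {f : Matrix n n (Unitization ℂ K)}
    (he : e * e = e) (hf : f * f = f) (heF : OverF F e) (hfF : OverF F f)
    {a : Matrix m n (Unitization ℂ K)} {b : Matrix n m (Unitization ℂ K)}
    (hab : a * b = e) (hba : b * a = f) : matSndTrace φ e = matSndTrace φ f := by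
  -- Cutting down to the corners of `e` and `f` keeps both relations.
  obtain ⟨a', b', hab', hba', hea, haf, hfb, hbe⟩ : ∃ (a' : Matrix m n (Unitization ℂ K))
      (b' : Matrix n m (Unitization ℂ K)), a' * b' = e ∧ b' * a' = f ∧ e * a' = a' ∧
        a' * f = a' ∧ f * b' = b' ∧ b' * e = b' := by
    have h1 : e * a = a * f := by rw [← hab, ← hba, Matrix.mul_assoc]
    have h2 : b * e = f * b := by rw [← hab, ← hba, Matrix.mul_assoc]
    refine ⟨e * a, f * b, ?_, ?_, ?_, ?_, ?_, ?_⟩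
    · rw [← h2, Matrix.mul_assoc, ← Matrix.mul_assoc a, hab, he, he]
    · rw [h1, Matrix.mul_assoc, ← Matrix.mul_assoc b, hba, hf, hf]
    · rw [← Matrix.mul_assoc, he]
    · rw [h1, Matrix.mul_assoc, hf]
    · rw [← Matrix.mul_assoc, hf]
    · rw [← h2, Matrix.mul_assoc, he]
  -- Both maps take the value `1` at `(a', b')`, so they stay invertible at a nearby pair over `F +
  -- ℂ`.
  let U : Matrix m n (Unitization ℂ K) × Matrix n m (Unitization ℂ K) →
      Matrix m m (Unitization ℂ K) := fun p => 1 - e + (e * p.1 * f) * (f * p.2 * e)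
  let V : Matrix m n (Unitization ℂ K) × Matrix n m (Unitization ℂ K) →
      Matrix n n (Unitization ℂ K) := fun p => 1 - f + (f * p.2 * e) * (e * p.1 * f)
  have hU : Continuous U := by fun_prop
  have hV : Continuous V := by fun_prop
  have hopen : IsOpen (U ⁻¹' {M | IsUnit M} ∩ V ⁻¹' {M | IsUnit M}) :=
    (isOpen_isUnit_matrix.preimage hU).inter (isOpen_isUnit_matrix.preimage hV)
  have hmem : (a', b') ∈ U ⁻¹' {M | IsUnit M} ∩ V ⁻¹' {M | IsUnit M} := by
    constructor
    · change IsUnit (1 - e + (e * a' * f) * (f * b' * e))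
      rw [hea, haf, hfb, hbe, hab', sub_add_cancel]
      exact isUnit_one
    · change IsUnit (1 - f + (f * b' * e) * (e * a' * f))
      rw [hea, haf, hfb, hbe, hba', sub_add_cancel]
      exact isUnit_one
  have hcl := h.mem_closure_overF a'
  have hcl2 := h.mem_closure_overF b'
  have hcl3 : (a', b') ∈ closure ({X | OverF F X ∧ scalarMat X = scalarMat a'} ×ˢ
      {X | OverF F X ∧ scalarMat X = scalarMat b'}) := by
    rw [closure_prod_eq]; exact ⟨hcl, hcl2⟩
  obtain ⟨⟨x, y⟩, ⟨⟨u, hu⟩, ⟨v, hv⟩⟩, ⟨hx, hxs⟩, ⟨hy, hys⟩⟩ :=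
    mem_closure_iff.1 hcl3 _ hopen hmem
  simp only at hx hxs hy hys
  change (u : Matrix m m (Unitization ℂ K)) = 1 - e + (e * x * f) * (f * y * e) at hu
  change (v : Matrix n n (Unitization ℂ K)) = 1 - f + (f * y * e) * (e * x * f) at hv
  set x' := e * x * f with hx'
  set y' := f * y * e with hy'
  have hex : e * x' = x' := by rw [hx', ← Matrix.mul_assoc, ← Matrix.mul_assoc, he]
  have hxf : x' * f = x' := by rw [hx', Matrix.mul_assoc, hf]
  have hfy : f * y' = y' := by rw [hy', ← Matrix.mul_assoc, ← Matrix.mul_assoc, hf]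
  have hye : y' * e = y' := by rw [hy', Matrix.mul_assoc, he]
  have hx'F : OverF F x' := h.overF_mul (h.overF_mul heF hx) hfF
  have hy'F : OverF F y' := h.overF_mul (h.overF_mul hfF hy) heF
  have hus : scalarMat (u : Matrix m m (Unitization ℂ K)) = 1 := by
    have : scalarMat (x' * y') = scalarMat e := by
      rw [← hab', scalarMat_mul, hx', hy', scalarMat_mul, scalarMat_mul, scalarMat_mul,
        scalarMat_mul, hxs, hys]
      simp only [← scalarMat_mul]
      rw [hea, haf, hfb, hbe]
    rw [hu, scalarMat_add, scalarMat_sub, this, scalarMat_one, sub_add_cancel]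
  have huF : OverF F (u : Matrix m m (Unitization ℂ K)) := by
    rw [hu]; exact (OverF.one.sub heF).add (h.overF_mul hx'F hy'F)
  have hrF : OverF F (↑u⁻¹ : Matrix m m (Unitization ℂ K)) :=
    h.overF_inverse huF hus u.mul_inv
  have heu : e * (u : Matrix m m (Unitization ℂ K)) = x' * y' := by
    rw [hu, Matrix.mul_add, Matrix.mul_sub, he, Matrix.mul_one, ← Matrix.mul_assoc, hex]; abel
  have hvf : (v : Matrix n n (Unitization ℂ K)) * f = y' * x' := by
    rw [hv, Matrix.add_mul, Matrix.sub_mul, hf, Matrix.one_mul, Matrix.mul_assoc y', hxf]; abel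
  -- Between the corners, `z` is a right inverse of `x'` and `z'` a left inverse, so they coincide.
  -- Only `u⁻¹` has to be over `F + ℂ`; `v` serves just to prove `z x' = f`.
  set z := y' * (↑u⁻¹ : Matrix m m (Unitization ℂ K)) with hz
  set z' := (↑v⁻¹ : Matrix n n (Unitization ℂ K)) * y' with hz'
  have hxz : x' * z = e := by
    rw [hz, ← Matrix.mul_assoc, ← heu, Matrix.mul_assoc, u.mul_inv, Matrix.mul_one]
  have hzx : z' * x' = f := by
    rw [hz', Matrix.mul_assoc, ← hvf, ← Matrix.mul_assoc, v.inv_mul, Matrix.one_mul]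
  have hzz : z' = z := by
    have h1 : z' * e = z' := by rw [hz', Matrix.mul_assoc, hye]
    have h2 : f * z = z := by rw [hz, ← Matrix.mul_assoc, hfy]
    rw [← h1, ← hxz, ← Matrix.mul_assoc, hzx, h2]
  rw [hzz] at hzx
  rw [← hxz, ← hzx]
  exact h.matSndTrace_mul_comm hx'F (h.overF_mul hy'F hrF)

/-- Every projection over the unitization of `K` is equivalent to a projection over `F + ℂ`. -/
theorem exists_overF_equiv {n : Type*} [Fintype n] [DecidableEq n]
    {p : Matrix n n (Unitization ℂ K)} (hp : IsStarProjection p) :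
    ∃ e v : Matrix n n (Unitization ℂ K), IsStarProjection e ∧ OverF F e ∧
      v.conjTranspose * v = p ∧ v * v.conjTranspose = e := by
  let := CStarAlgebra.spectralOrder (Unitization ℂ K)
  have := CStarAlgebra.spectralOrderedRing (Unitization ℂ K)
  have hp' : IsStarProjection (CStarMatrix.ofMatrix p) := ⟨hp.1, hp.2⟩
  -- The condition is put on the self-adjoint part of `X`, since density alone does not provide a
  -- self-adjoint approximant.
  have hopen : IsOpen {X : Matrix n n (Unitization ℂ K) |
      ‖CStarMatrix.ofMatrix ((1 / 2 : ℂ) • (X + X.conjTranspose)) - CStarMatrix.ofMatrix p‖ <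
        1 / 10} := by
    refine isOpen_lt (Continuous.norm (Continuous.sub ?_ continuous_const)) continuous_const
    have hc : Continuous fun X : Matrix n n (Unitization ℂ K) =>
        (1 / 2 : ℂ) • (X + X.conjTranspose) := by fun_prop
    exact CStarMatrix.ofMatrixL.continuous.comp hc
  have hps : p.conjTranspose = p := hp.isSelfAdjoint
  have hpp : p * p = p := hp.isIdempotentElem
  have hhalf : (1 / 2 : ℂ) • (p + p.conjTranspose) = p := by
    rw [hps, ← two_smul ℂ, smul_smul]; norm_num
  obtain ⟨x₀, hx₀, hxF, hxs⟩ := mem_closure_iff.1 (h.mem_closure_overF p) _ hopen (by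
    rw [Set.mem_ofPred_eq, hhalf]; simp)
  set x := (1 / 2 : ℂ) • (x₀ + x₀.conjTranspose) with hx
  have hsx : scalarMat x = scalarMat p := by
    have e : ∀ i j, (x₀ i j).fst = (p i j).fst := fun i j => congr_fun (congr_fun hxs i) j
    ext i j
    have e2 := congr_fun (congr_fun hhalf i) j
    have e3 := congr_arg (Unitization.fstHom ℂ K) e2
    simp only [Matrix.smul_apply, Matrix.add_apply, Matrix.conjTranspose_apply,
      Unitization.fstHom_apply,
      Unitization.fst_smul, Unitization.fst_add, Unitization.fst_star] at e3
    simp only [hx, Matrix.map_apply, Matrix.smul_apply, Matrix.add_apply,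
      Matrix.conjTranspose_apply, Unitization.fstHom_apply,
      Unitization.fst_smul, Unitization.fst_add, Unitization.fst_star, e, e3]
  have hxF' : OverF F x := (hxF.add (h.overF_conjTranspose hxF)).smul _
  have hxsa : IsSelfAdjoint (CStarMatrix.ofMatrix x) := by
    change x.conjTranspose = x
    rw [hx, Matrix.conjTranspose_smul, Matrix.conjTranspose_add, Matrix.conjTranspose_conjTranspose,
      add_comm]
    simp
  obtain ⟨e, k, he, hen, hek⟩ := exists_isStarProjection_near hp' hxsa hx₀
  obtain ⟨v, hv1, hv2⟩ := exists_partialIsometry_of_norm_sub_lt_one hp' he hen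
  refine ⟨CStarMatrix.ofMatrix.symm e, CStarMatrix.ofMatrix.symm v, ⟨he.1, he.2⟩, ?_, hv1, hv2⟩
  have hek' : CStarMatrix.ofMatrix.symm e = x + (x * x - x) * CStarMatrix.ofMatrix.symm k := hek
  rw [hek']
  -- The scalar part of `x` is that of `p`, an idempotent, so `x² - x` has scalar part zero.
  refine hxF'.add (h.inF_mul_right _ (((h.overF_mul hxF' hxF').sub hxF').inF ?_)).overF
  rw [scalarMat_sub, scalarMat_mul, hsx, ← scalarMat_mul, hpp, sub_self]

/-- A projection over `K` has entries in `F`. -/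
theorem inF_of_isIdempotentElem {n : Type*} [Fintype n] [DecidableEq n]
    {p : Matrix n n (Unitization ℂ K)} (hpp : p * p = p) (hs : scalarMat p = 0) :
    InF F p := by
  let U : Matrix n n (Unitization ℂ K) → Matrix n n (Unitization ℂ K) :=
    fun x => 1 - p + p * x * p
  have hU : Continuous U := by fun_prop
  obtain ⟨x, ⟨u, hu⟩, hxF, hxs⟩ := mem_closure_iff.1 (h.mem_closure_overF p) _
    (isOpen_isUnit_matrix.preimage hU) (by
      change IsUnit (1 - p + p * p * p)
      rw [hpp, hpp, sub_add_cancel]; exact isUnit_one)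
  change (u : Matrix n n (Unitization ℂ K)) = 1 - p + p * x * p at hu
  -- The approximant has the scalar part of `p`, namely zero, so it is over `F`.
  have h1 : InF F (p * x * p) := h.inF_mul_right _ (h.inF_mul_left _ (hxF.inF (hxs.trans hs)))
  have h2 : p * x * p = p * u := by
    rw [hu, Matrix.mul_add, Matrix.mul_sub, hpp, Matrix.mul_one, ← Matrix.mul_assoc,
      ← Matrix.mul_assoc, hpp]; abel
  have h3 : p = p * x * p * (↑u⁻¹ : Matrix n n (Unitization ℂ K)) := by
    rw [h2, Matrix.mul_assoc, u.mul_inv, Matrix.mul_one]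
  rw [h3]
  exact h.inF_mul_right _ h1

end IsDenseTraceIdeal

end Projections

/-! ### The homomorphism on `K₀` induced by the trace. -/

section KTheory

namespace KZeroUnital

variable {A : Type*} [Ring A] [StarRing A]

theorem mk_eq_of_mvN {p q : ProjMat A} (h : p.MvN q) : mk p = mk q :=
  QuotientAddGroup.eq_iff_sub_mem.2 (AddSubgroup.subset_closure (Or.inl ⟨p, q, h, rfl⟩))

theorem mk_dsum (p q : ProjMat A) : mk (p.dsum q) = mk p + mk q := by
  rw [mk, mk, mk, ← QuotientAddGroup.mk_add]
  exact QuotientAddGroup.eq_iff_sub_mem.2 (AddSubgroup.subset_closure (Or.inr ⟨p, q, rfl⟩))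

/-- The zero matrix implements `0 ⊕ 0 ∼ 0`, so the class `c` satisfies `c + c = c`. -/
theorem mk_zero (n : ℕ) (h : IsStarProjection (0 : Matrix (Fin n) (Fin n) A)) :
    mk (⟨n, 0, h⟩ : ProjMat A) = 0 := by
  have h1 : mk ((⟨n, 0, h⟩ : ProjMat A).dsum ⟨n, 0, h⟩) = mk (⟨n, 0, h⟩ : ProjMat A) :=
    mk_eq_of_mvN ⟨0, (Matrix.mul_zero _).trans (by simp [ProjMat.dsum]; rfl), Matrix.zero_mul _⟩
  rw [mk_dsum] at h1
  exact add_eq_left.1 h1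

/-- Every element of `K₀` is a difference of the classes of two projections of the same size. -/
theorem exists_eq_sub (z : KZeroUnital A) :
    ∃ (n : ℕ) (p q : Matrix (Fin n) (Fin n) A) (hp : IsStarProjection p)
      (hq : IsStarProjection q), z = mk ⟨n, p, hp⟩ - mk ⟨n, q, hq⟩ := by
  have key : ∃ p q : ProjMat A, z = mk p - mk q := by
    have h0 : ∀ n, IsStarProjection (0 : Matrix (Fin n) (Fin n) A) :=
      fun n => IsStarProjection.zero _
    obtain ⟨z, rfl⟩ := QuotientAddGroup.mk_surjective z
    induction z using FreeAbelianGroup.induction_on with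
    | zero => exact ⟨⟨0, 0, h0 0⟩, ⟨0, 0, h0 0⟩, by simp⟩
    | of p => exact ⟨p, ⟨0, 0, h0 0⟩, by rw [mk_zero, sub_zero]; rfl⟩
    | neg p _ => exact ⟨⟨0, 0, h0 0⟩, p, by rw [mk_zero, zero_sub]; rfl⟩
    | add x y hx hy =>
      obtain ⟨p, q, hpq⟩ := hx
      obtain ⟨p', q', hpq'⟩ := hy
      refine ⟨p.dsum p', q.dsum q', ?_⟩
      rw [QuotientAddGroup.mk_add, hpq, hpq', mk_dsum, mk_dsum]
      abel
  obtain ⟨p, q, rfl⟩ := key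
  -- Padding by zero blocks, `p ⊕ 0` and `0 ⊕ q`, equalizes the sizes.
  let p' : ProjMat A := p.dsum ⟨q.size, 0, IsStarProjection.zero _⟩
  let q' : ProjMat A := (⟨p.size, 0, IsStarProjection.zero _⟩ : ProjMat A).dsum q
  refine ⟨p.size + q.size, p'.mat, q'.mat, p'.isProj, q'.isProj, ?_⟩
  change mk p - mk q = mk p' - mk q'
  rw [mk_dsum, mk_dsum, mk_zero, mk_zero, add_zero, zero_add]

end KZeroUnital

variable {K : Type*} [NonUnitalCStarAlgebra K] {F : Submodule ℂ K} {φ : K → ℂ}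

namespace IsDenseTraceIdeal

theorem im_matSndTrace_eq_zero (h : IsDenseTraceIdeal F φ) {n : Type*} [Fintype n]
    {e : Matrix n n (Unitization ℂ K)} (he : e.conjTranspose = e) (heF : OverF F e) :
    (matSndTrace φ e).im = 0 := by
  rw [matSndTrace, Complex.im_sum]
  refine Finset.sum_eq_zero fun i _ => h.im_eq_zero _ (heF i i) ?_
  have := congr_fun (congr_fun he i) i
  rw [Matrix.conjTranspose_apply] at this
  rw [IsSelfAdjoint, ← Unitization.snd_star, this]

/-- The trace of the class of a projection over the unitization of `K`, computed on an equivalent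
projection over `F + ℂ`. -/
def projTrace (h : IsDenseTraceIdeal F φ) (p : ProjMat (Unitization ℂ K)) : ℝ :=
  (matSndTrace φ (h.exists_overF_equiv p.isProj).choose).re

variable (h : IsDenseTraceIdeal F φ)

/-- This makes the value independent of the chosen representative. The index type is arbitrary so
that block matrices over a sum type can be used directly, and the equivalence need only be
algebraic. -/
theorem projTrace_eq {n : Type*} [Fintype n] [DecidableEq n] {p : ProjMat (Unitization ℂ K)}
    {e : Matrix n n (Unitization ℂ K)} (he : e * e = e) (heF : OverF F e)
    {a : Matrix (Fin p.size) n (Unitization ℂ K)} {b : Matrix n (Fin p.size) (Unitization ℂ K)}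
    (hab : a * b = p.mat) (hba : b * a = e) : h.projTrace p = (matSndTrace φ e).re := by
  obtain ⟨v, hf, hfF, hv1, hv2⟩ := (h.exists_overF_equiv p.isProj).choose_spec
  rw [projTrace]
  set f := (h.exists_overF_equiv p.isProj).choose
  have hff : f * f = f := hf.isIdempotentElem
  congr 1
  refine h.matSndTrace_eq_of_equiv hff he hfF heF (a := v * a) (b := b * v.conjTranspose) ?_ ?_
  · rw [Matrix.mul_assoc, ← Matrix.mul_assoc a, hab, ← hv1, Matrix.mul_assoc, hv2,
      ← Matrix.mul_assoc, hv2, hff]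
  · rw [Matrix.mul_assoc, ← Matrix.mul_assoc _ v, hv1, ← hab, Matrix.mul_assoc,
      ← Matrix.mul_assoc b, hba, he]

theorem projTrace_eq_of_mvN {p q : ProjMat (Unitization ℂ K)} (hpq : p.MvN q) :
    h.projTrace p = h.projTrace q := by
  obtain ⟨v, hv1, hv2⟩ := hpq
  obtain ⟨w, hf, hfF, hw1, hw2⟩ := (h.exists_overF_equiv q.isProj).choose_spec
  rw [projTrace.eq_def h q]
  set f := (h.exists_overF_equiv q.isProj).choose
  have hff : f * f = f := hf.isIdempotentElem
  have hpp : p.mat * p.mat = p.mat := p.isProj.isIdempotentElem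
  refine h.projTrace_eq hff hfF (a := v.conjTranspose * w.conjTranspose) (b := w * v) ?_ ?_
  · rw [Matrix.mul_assoc, ← Matrix.mul_assoc _ w, hw1, ← hv2, Matrix.mul_assoc v, hv1,
      ← Matrix.mul_assoc, hv1, hpp]
  · rw [Matrix.mul_assoc, ← Matrix.mul_assoc v, hv2, ← hw1, Matrix.mul_assoc, hw2,
      ← Matrix.mul_assoc, hw2, hff]

theorem projTrace_dsum (p q : ProjMat (Unitization ℂ K)) :
    h.projTrace (p.dsum q) = h.projTrace p + h.projTrace q := by
  obtain ⟨v, hf, hfF, hv1, hv2⟩ := (h.exists_overF_equiv p.isProj).choose_spec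
  obtain ⟨w, hg, hgF, hw1, hw2⟩ := (h.exists_overF_equiv q.isProj).choose_spec
  rw [projTrace.eq_def h q, projTrace.eq_def h p]
  set f := (h.exists_overF_equiv p.isProj).choose
  set g := (h.exists_overF_equiv q.isProj).choose
  have hff : f * f = f := hf.isIdempotentElem
  have hgg : g * g = g := hg.isIdempotentElem
  have hsum : matSndTrace φ (Matrix.fromBlocks f 0 0 g) = matSndTrace φ f + matSndTrace φ g := by
    simp [matSndTrace, Fintype.sum_sum_type]
  rw [← Complex.add_re, ← hsum]
  let σ : Fin (p.dsum q).size ≃ Fin p.size ⊕ Fin q.size := finSumFinEquiv.symm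
  refine h.projTrace_eq (p := p.dsum q) ?_ ?_
    (a := (Matrix.fromBlocks v.conjTranspose 0 0 w.conjTranspose).submatrix σ id)
    (b := (Matrix.fromBlocks v 0 0 w).submatrix id σ) ?_ ?_
  · simp [Matrix.fromBlocks_multiply, hff, hgg]
  · rintro (i | i) (j | j)
    · exact hfF i j
    · simp
    · simp
    · exact hgF i j
  · change _ = (Matrix.fromBlocks p.mat 0 0 q.mat).submatrix σ σ
    rw [← Matrix.submatrix_mul _ _ _ id _ Function.bijective_id]
    simp [Matrix.fromBlocks_multiply, hv1, hw1]
  · rw [Matrix.submatrix_mul_equiv]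
    simp [Matrix.fromBlocks_multiply, hv2, hw2]

/-- The homomorphism on `K₀` of the unitization of `K` induced by the trace. -/
def kTrace : KZeroUnital (Unitization ℂ K) →+ ℝ :=
  QuotientAddGroup.lift _ (FreeAbelianGroup.lift h.projTrace) <| by
    rw [AddSubgroup.closure_le]
    rintro z (⟨p, q, hpq, rfl⟩ | ⟨p, q, rfl⟩)
    · simp [AddMonoidHom.mem_ker, h.projTrace_eq_of_mvN hpq]
    · simp [AddMonoidHom.mem_ker, h.projTrace_dsum p q]

theorem kTrace_mk (p : ProjMat (Unitization ℂ K)) :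
    h.kTrace (KZeroUnital.mk p) = h.projTrace p := by
  simp [kTrace, KZeroUnital.mk]

/-- Every class in `K₀(K)` is a difference of classes of projections of the same size
over `F + ℂ`. -/
theorem exists_eq_diff (h : IsDenseTraceIdeal F φ) (z : KZero K) :
    ∃ (n : ℕ) (p q : Matrix (Fin n) (Fin n) (Unitization ℂ K)) (hp : IsStarProjection p)
      (hq : IsStarProjection q) (hpq : KZeroUnital.mk (ProjMat.map (scalarPart K) ⟨n, p, hp⟩) =
        KZeroUnital.mk (ProjMat.map (scalarPart K) ⟨n, q, hq⟩)),
      OverF F p ∧ OverF F q ∧ z = KZero.diff ⟨n, p, hp⟩ ⟨n, q, hq⟩ hpq := by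
  obtain ⟨z, hz⟩ := z
  obtain ⟨n, p, q, hp, hq, rfl⟩ := KZeroUnital.exists_eq_sub z
  obtain ⟨e, v, he, heF, hv1, hv2⟩ := h.exists_overF_equiv hp
  obtain ⟨f, w, hf, hfF, hw1, hw2⟩ := h.exists_overF_equiv hq
  have h1 : KZeroUnital.mk (⟨n, p, hp⟩ : ProjMat (Unitization ℂ K)) = KZeroUnital.mk ⟨n, e, he⟩ :=
    KZeroUnital.mk_eq_of_mvN ⟨v, hv1, hv2⟩
  have h2 : KZeroUnital.mk (⟨n, q, hq⟩ : ProjMat (Unitization ℂ K)) = KZeroUnital.mk ⟨n, f, hf⟩ :=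
    KZeroUnital.mk_eq_of_mvN ⟨w, hw1, hw2⟩
  refine ⟨n, e, f, he, hf, ?_, heF, hfF, ?_⟩
  · rw [KZero, AddMonoidHom.mem_ker, map_sub, h1, h2, KZeroUnital.map_mk, KZeroUnital.map_mk,
      sub_eq_zero] at hz
    exact hz
  · refine Subtype.ext ?_
    change KZeroUnital.mk _ - KZeroUnital.mk _ = KZeroUnital.mk _ - KZeroUnital.mk _
    rw [h1, h2]

/-- The trace on `F` induces a unique homomorphism `K₀(K) → ℝ`. -/
theorem existsUnique_kZero_trace (h : IsDenseTraceIdeal F φ) :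
    ∃! τs : KZero K →+ ℝ,
      ∀ (n : ℕ) (p q : Matrix (Fin n) (Fin n) (Unitization ℂ K))
        (hp : IsStarProjection p) (hq : IsStarProjection q), OverF F p → OverF F q →
        ∀ hpq : KZeroUnital.mk (ProjMat.map (scalarPart K) ⟨n, p, hp⟩) =
            KZeroUnital.mk (ProjMat.map (scalarPart K) ⟨n, q, hq⟩),
          ((τs (KZero.diff ⟨n, p, hp⟩ ⟨n, q, hq⟩ hpq) : ℝ) : ℂ) =
            matSndTrace φ p - matSndTrace φ q := by
  have key : ∀ (n : ℕ) (p : Matrix (Fin n) (Fin n) (Unitization ℂ K)) (hp : IsStarProjection p),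
      OverF F p → ((h.kTrace (KZeroUnital.mk ⟨n, p, hp⟩) : ℝ) : ℂ) = matSndTrace φ p := by
    intro n p hp hpF
    have hpp : p * p = p := hp.isIdempotentElem
    rw [kTrace_mk, h.projTrace_eq (p := ⟨n, p, hp⟩) hpp hpF (a := p) (b := p) hpp hpp]
    exact Complex.ext rfl (h.im_matSndTrace_eq_zero hp.isSelfAdjoint hpF).symm
  refine ⟨h.kTrace.comp (KZero K).subtype, ?_, ?_⟩
  · intro n p q hp hq hpF hqF hpq
    rw [← key n p hp hpF, ← key n q hq hqF, ← Complex.ofReal_sub, ← map_sub]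
    rfl
  -- Differences of projections over `F + ℂ` exhaust `K₀(K)`, and the formula fixes `σ` on them.
  · intro σ hσ
    ext z
    obtain ⟨n, p, q, hp, hq, hpq, hpF, hqF, rfl⟩ := h.exists_eq_diff z
    apply Complex.ofReal_injective
    rw [hσ n p q hp hq hpF hqF hpq, ← key n p hp hpF, ← key n q hq hqF, ← Complex.ofReal_sub,
      ← map_sub]
    rfl

end IsDenseTraceIdeal

end KTheory

/-! ### Linearity and traciality of the extended trace on `ℱ_N`. -/

section Traces

variable {H : Type*} [NormedAddCommGroup H] [InnerProductSpace ℂ H] [CompleteSpace H]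

namespace VonNeumannAlgebra

variable (N : VonNeumannAlgebra H)

theorem isClosed : IsClosed (N : Set (H →L[ℂ] H)) := by
  rw [← N.centralizer_centralizer]
  exact Set.isClosed_centralizer _

theorem cfc_mem (f : ℝ → ℝ) {x : H →L[ℂ] H} (hx : x ∈ N) : cfc f x ∈ N :=
  _root_.cfc_mem (𝕜' := ℂ) (s := N.toStarSubalgebra) (hs := N.isClosed) f hx

theorem posPart_mem {x : H →L[ℂ] H} (hx : x ∈ N) : x⁺ ∈ N := by
  rw [CFC.posPart_def, cfcₙ_eq_cfc]
  exact N.cfc_mem _ hx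

theorem smul_mem (c : ℂ) {x : H →L[ℂ] H} (hx : x ∈ N) : c • x ∈ N :=
  N.toStarSubalgebra.smul_mem hx c

theorem real_smul_mem (c : ℝ) {x : H →L[ℂ] H} (hx : x ∈ N) : c • x ∈ N := by
  rw [← Complex.coe_smul]; exact N.smul_mem _ hx

end VonNeumannAlgebra

variable {N : VonNeumannAlgebra H} {τ : (H →L[ℂ] H) → ℝ≥0∞}

/-- A difference of two positive elements of `N` of finite trace. -/
def IsTraceDiff (N : VonNeumannAlgebra H) (τ : (H →L[ℂ] H) → ℝ≥0∞) (x : H →L[ℂ] H) : Prop :=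
  ∃ u ∈ N, ∃ v ∈ N, 0 ≤ u ∧ 0 ≤ v ∧ τ u < ∞ ∧ τ v < ∞ ∧ x = u - v

/-- The trace of a self-adjoint element, computed on its positive and negative parts. -/
def saTrace (τ : (H →L[ℂ] H) → ℝ≥0∞) (x : H →L[ℂ] H) : ℝ := (τ x⁺).toReal - (τ x⁻).toReal

theorem linTrace_eq (x : H →L[ℂ] H) :
    linTrace τ x = (saTrace τ (realPart x : H →L[ℂ] H) : ℂ) +
      (saTrace τ (imaginaryPart x : H →L[ℂ] H) : ℂ) * Complex.I := rfl

theorem coe_realPart_smul (c : ℂ) (x : H →L[ℂ] H) : (realPart (c • x) : H →L[ℂ] H) =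
    c.re • (realPart x : H →L[ℂ] H) + (-c.im) • (imaginaryPart x : H →L[ℂ] H) := by
  rw [realPart_smul, AddSubgroup.coe_sub, selfAdjoint.val_smul, selfAdjoint.val_smul, neg_smul,
    sub_eq_add_neg]

theorem coe_imaginaryPart_smul (c : ℂ) (x : H →L[ℂ] H) : (imaginaryPart (c • x) : H →L[ℂ] H) =
    c.re • (imaginaryPart x : H →L[ℂ] H) + c.im • (realPart x : H →L[ℂ] H) := by
  rw [imaginaryPart_smul, AddSubgroup.coe_add, selfAdjoint.val_smul, selfAdjoint.val_smul]

theorem linTrace_of_isSelfAdjoint {x : H →L[ℂ] H} (hx : IsSelfAdjoint x) :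
    linTrace τ x = (saTrace τ x : ℂ) := by
  rw [linTrace_eq, hx.coe_realPart, hx.imaginaryPart]
  simp [saTrace]

namespace IsFNSTrace

variable (hτ : IsFNSTrace N τ)
include hτ

theorem map_zero : τ 0 = 0 := by
  have := hτ.smul 0 0 (zero_mem N) le_rfl
  simpa using this

theorem map_real_smul {c : ℝ} (hc : 0 ≤ c) {x : H →L[ℂ] H} (hx : x ∈ N) (h0 : 0 ≤ x) :
    τ (c • x) = ENNReal.ofReal c * τ x := by
  have := hτ.smul c.toNNReal x hx h0
  rw [← Complex.coe_smul]
  rwa [show ((c.toNNReal : ℝ≥0) : ℂ) = ((c.toNNReal : ℝ) : ℂ) from rfl,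
    Real.coe_toNNReal c hc] at this

theorem mono {x y : H →L[ℂ] H} (hx : x ∈ N) (hy : y ∈ N) (h0 : 0 ≤ x) (hxy : x ≤ y) :
    τ x ≤ τ y := by
  have := hτ.add x hx (y - x) (sub_mem hy hx) h0 (sub_nonneg.2 hxy)
  rw [add_sub_cancel] at this
  rw [this]
  exact le_self_add

/-- With `s = √u`, traciality turns `a s s a*` into `s a* a s`, which is at most `‖a* a‖ u`. -/
theorem conjugate_le {a u : H →L[ℂ] H} (ha : a ∈ N) (hu : u ∈ N) (h0 : 0 ≤ u) :
    τ (a * u * star a) ≤ ENNReal.ofReal ‖star a * a‖ * τ u := by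
  set s := cfc Real.sqrt u with hs
  have hsN : s ∈ N := N.cfc_mem _ hu
  have hss : s * s = u := by
    rw [hs, ← cfc_mul _ _ u]
    conv_rhs => rw [← cfc_id' ℝ u]
    exact cfc_congr fun t ht => Real.mul_self_sqrt (spectrum_nonneg_of_nonneg h0 ht)
  have hsa : star s = s := (IsSelfAdjoint.cfc : IsSelfAdjoint (cfc Real.sqrt u)).star_eq
  have e1 : a * u * star a = (a * s) * star (a * s) := by
    rw [star_mul, hsa, ← hss]; simp only [mul_assoc]
  have e2 : star (a * s) * (a * s) = star s * (star a * a) * s := by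
    rw [star_mul]; simp only [mul_assoc]
  have haN : star a * a ∈ N := mul_mem (star_mem ha) ha
  have h1 : star s * (star a * a) * s ∈ N := mul_mem (mul_mem (star_mem hsN) haN) hsN
  rw [e1, ← hτ.trace _ (mul_mem ha hsN), e2, ← hτ.map_real_smul (norm_nonneg _) hu h0]
  refine hτ.mono h1 (N.real_smul_mem _ hu) ?_ ?_
  · rw [← e2]; exact star_mul_self_nonneg _
  · have := CStarAlgebra.star_left_conjugate_le_norm_smul (a := s) (b := star a * a)
      (.star_mul_self a)
    simpa only [hsa, hss] using this

/-- Compressing `x ≤ u` by the spectral projection of `x` on `(0, ∞)` would give this, but that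
projection is not a continuous function of `x`. The cut-offs `(x - ε)₊` increase to `x⁺` and equal
`g(x) x g(x) ≤ g(x) u g(x)` with `g` continuous and `g² ≤ 1`; normality passes to the limit. -/
theorem posPart_le {x u : H →L[ℂ] H} (hx : x ∈ N) (hsa : IsSelfAdjoint x) (hu : u ∈ N)
    (h0 : 0 ≤ u) (hxu : x ≤ u) : τ x⁺ ≤ τ u := by
  let f : ℕ → ℝ → ℝ := fun n t => max (t - 1 / ((n : ℝ) + 1)) 0
  have hf : ∀ n, Continuous (f n) := fun n => by fun_prop
  have hpos : x⁺ = cfc (fun t : ℝ => max t 0) x := by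
    rw [CFC.posPart_def, cfcₙ_eq_cfc]; rfl
  have hlub : IsLUB (Set.range fun n => cfc (f n) x) x⁺ := by
    constructor
    · rintro _ ⟨n, rfl⟩
      rw [hpos]
      refine cfc_mono (fun t _ => max_le_max ?_ le_rfl) (hf n).continuousOn
      have : (0 : ℝ) ≤ 1 / ((n : ℝ) + 1) := by positivity
      linarith
    · intro b hb
      have h1 : ∀ n : ℕ, x⁺ ≤ b + algebraMap ℝ (H →L[ℂ] H) (1 / ((n : ℝ) + 1)) := by
        intro n
        have h2 : x⁺ ≤ cfc (f n) x + algebraMap ℝ (H →L[ℂ] H) (1 / ((n : ℝ) + 1)) := by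
          rw [hpos, ← cfc_add_const _ _ x (hf n).continuousOn]
          refine cfc_mono (fun t _ => ?_) (by fun_prop) ((hf n).add continuous_const).continuousOn
          have : (0 : ℝ) ≤ 1 / ((n : ℝ) + 1) := by positivity
          refine max_le ?_ (add_nonneg (le_max_right _ _) this)
          have := le_max_left (t - 1 / ((n : ℝ) + 1)) 0
          simp only [f]
          linarith
        exact h2.trans (by gcongr; exact hb ⟨n, rfl⟩)
      have h3 : Filter.Tendsto (fun n : ℕ => b + algebraMap ℝ (H →L[ℂ] H) (1 / ((n : ℝ) + 1)))
          Filter.atTop (nhds (b + algebraMap ℝ (H →L[ℂ] H) 0)) :=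
        tendsto_const_nhds.add
          (((continuous_algebraMap ℝ (H →L[ℂ] H)).tendsto 0).comp
            tendsto_one_div_add_atTop_nhds_zero_nat)
      rw [_root_.map_zero, add_zero] at h3
      exact ge_of_tendsto' h3 h1
  have hmono : Monotone fun n => cfc (f n) x := by
    intro m n hmn
    refine cfc_mono (fun t _ => max_le_max ?_ le_rfl) (hf m).continuousOn (hf n).continuousOn
    have : 1 / ((n : ℝ) + 1) ≤ 1 / ((m : ℝ) + 1) := by gcongr
    linarith
  have hmem : ∀ s ∈ Set.range fun n => cfc (f n) x, s ∈ N ∧ 0 ≤ s := by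
    rintro _ ⟨n, rfl⟩
    exact ⟨N.cfc_mem _ hx, cfc_nonneg fun t _ => le_max_right _ _⟩
  rw [hτ.normal _ _ (Set.range_nonempty _) (directedOn_range.2 hmono.directed_le) hmem
    (N.posPart_mem hx) hlub]
  refine iSup₂_le ?_
  rintro _ ⟨n, rfl⟩
  set ε : ℝ := 1 / ((n : ℝ) + 1) with hε
  have hε0 : 0 < ε := by positivity
  -- Chosen so that `g(t)² t = (t - ε)₊`; the denominator `max t ε` keeps `g` continuous.
  let g : ℝ → ℝ := fun t => √(max (t - ε) 0 / max t ε)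
  have hmax : ∀ t : ℝ, 0 < max t ε := fun t => lt_max_of_lt_right hε0
  have hg : Continuous g :=
    Real.continuous_sqrt.comp (Continuous.div (by fun_prop) (by fun_prop) fun t => (hmax t).ne')
  have hgsq : ∀ t, g t * g t = max (t - ε) 0 / max t ε := fun t =>
    Real.mul_self_sqrt (div_nonneg (le_max_right _ _) (hmax t).le)
  have hg1 : ∀ t, g t * g t ≤ 1 := fun t => by
    rw [hgsq, div_le_one (hmax t)]
    refine max_le ?_ (hmax t).le
    have := le_max_left t ε
    linarith
  have hgsa : star (cfc g x) = cfc g x := (IsSelfAdjoint.cfc : IsSelfAdjoint (cfc g x)).star_eq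
  have hfg : cfc (f n) x = cfc g x * x * star (cfc g x) := by
    rw [hgsa]
    conv_rhs => enter [1, 2]; rw [← cfc_id' ℝ x]
    rw [← cfc_mul g (fun t => t) x hg.continuousOn,
      ← cfc_mul (fun t => g t * t) g x (hg.mul continuous_id).continuousOn hg.continuousOn]
    refine cfc_congr fun t _ => ?_
    change max (t - ε) 0 = g t * t * g t
    rw [mul_right_comm, hgsq]
    rcases le_total t ε with ht | ht
    · rw [max_eq_right (sub_nonpos.2 ht)]; simp
    · rw [max_eq_left ht, div_mul_cancel₀]
      linarith
  have hle : cfc (f n) x ≤ cfc g x * u * star (cfc g x) := by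
    rw [hfg]; exact star_right_conjugate_le_conjugate hxu _
  have hgN : cfc g x ∈ N := N.cfc_mem _ hx
  calc τ (cfc (f n) x) ≤ τ (cfc g x * u * star (cfc g x)) :=
        hτ.mono (N.cfc_mem _ hx) (mul_mem (mul_mem hgN hu) (star_mem hgN))
          (hmem _ ⟨n, rfl⟩).2 hle
    _ ≤ ENNReal.ofReal ‖star (cfc g x) * cfc g x‖ * τ u := hτ.conjugate_le hgN hu h0
    _ ≤ 1 * τ u := by
        gcongr
        refine ENNReal.ofReal_le_one.2 ?_
        rw [hgsa, ← cfc_mul g g x hg.continuousOn hg.continuousOn]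
        refine norm_cfc_le zero_le_one fun t _ => ?_
        rw [Real.norm_eq_abs, abs_of_nonneg (mul_self_nonneg _)]
        exact hg1 t
    _ = τ u := one_mul _

/-- For `x = u - v`, both `x⁺` and `x⁻` have finite trace by `posPart_le`, so `τ` can be applied to
`x⁺ + v = u + x⁻` and the terms rearranged. -/
theorem saTrace_sub {u v : H →L[ℂ] H} (hu : u ∈ N) (hv : v ∈ N) (hu0 : 0 ≤ u) (hv0 : 0 ≤ v)
    (huf : τ u < ∞) (hvf : τ v < ∞) : saTrace τ (u - v) = (τ u).toReal - (τ v).toReal := by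
  have hsa : IsSelfAdjoint (u - v) := hu0.isSelfAdjoint.sub hv0.isSelfAdjoint
  have hN : u - v ∈ N := sub_mem hu hv
  have hN' : v - u ∈ N := sub_mem hv hu
  have hneg : (u - v)⁻ = (v - u)⁺ := by rw [← CFC.posPart_neg, neg_sub]
  have h1 : τ (u - v)⁺ < ∞ :=
    (hτ.posPart_le hN hsa hu hu0 (sub_le_self _ hv0)).trans_lt huf
  have h2 : τ (u - v)⁻ < ∞ := by
    rw [hneg]
    exact (hτ.posPart_le hN' (hv0.isSelfAdjoint.sub hu0.isSelfAdjoint) hv hv0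
      (sub_le_self _ hu0)).trans_lt hvf
  have h3 : (u - v)⁺ + v = u + (u - v)⁻ := by
    have h4 : (u - v)⁺ = u - v + (u - v)⁻ := by
      rw [← sub_eq_iff_eq_add]; exact CFC.posPart_sub_negPart _ hsa
    rw [h4]; abel
  have h4 : (u - v)⁻ ∈ N := by rw [hneg]; exact N.posPart_mem hN'
  have h5 := congr_arg τ h3
  rw [hτ.add _ (N.posPart_mem hN) _ hv (CFC.posPart_nonneg _) hv0,
    hτ.add _ hu _ h4 hu0 (CFC.negPart_nonneg _)] at h5
  have h6 := congr_arg ENNReal.toReal h5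
  rw [ENNReal.toReal_add h1.ne hvf.ne, ENNReal.toReal_add huf.ne h2.ne] at h6
  rw [saTrace]
  linarith

theorem isTraceDiff_add {x y : H →L[ℂ] H} (hx : IsTraceDiff N τ x) (hy : IsTraceDiff N τ y) :
    IsTraceDiff N τ (x + y) ∧ saTrace τ (x + y) = saTrace τ x + saTrace τ y := by
  obtain ⟨u, hu, v, hv, hu0, hv0, huf, hvf, rfl⟩ := hx
  obtain ⟨u', hu', v', hv', hu0', hv0', huf', hvf', rfl⟩ := hy
  have e : u - v + (u' - v') = (u + u') - (v + v') := by abel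
  have h1 := hτ.add _ hu _ hu' hu0 hu0'
  have h2 := hτ.add _ hv _ hv' hv0 hv0'
  have h3 : τ (u + u') < ∞ := by rw [h1]; exact ENNReal.add_lt_top.2 ⟨huf, huf'⟩
  have h4 : τ (v + v') < ∞ := by rw [h2]; exact ENNReal.add_lt_top.2 ⟨hvf, hvf'⟩
  refine ⟨⟨u + u', add_mem hu hu', v + v', add_mem hv hv', add_nonneg hu0 hu0',
    add_nonneg hv0 hv0', h3, h4, e⟩, ?_⟩
  rw [e, hτ.saTrace_sub (add_mem hu hu') (add_mem hv hv') (add_nonneg hu0 hu0')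
    (add_nonneg hv0 hv0') h3 h4, hτ.saTrace_sub hu hv hu0 hv0 huf hvf,
    hτ.saTrace_sub hu' hv' hu0' hv0' huf' hvf', h1, h2, ENNReal.toReal_add huf.ne huf'.ne,
    ENNReal.toReal_add hvf.ne hvf'.ne]
  ring

theorem isTraceDiff_smul (c : ℝ) {x : H →L[ℂ] H} (hx : IsTraceDiff N τ x) :
    IsTraceDiff N τ (c • x) ∧ saTrace τ (c • x) = c * saTrace τ x := by
  obtain ⟨u, hu, v, hv, hu0, hv0, huf, hvf, rfl⟩ := hx
  have key : ∀ c : ℝ, 0 ≤ c → ∀ u ∈ N, 0 ≤ u → τ u < ∞ → c • u ∈ N ∧ 0 ≤ c • u ∧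
      τ (c • u) < ∞ ∧ (τ (c • u)).toReal = c * (τ u).toReal := by
    intro c hc u hu hu0 huf
    have := hτ.map_real_smul hc hu hu0
    refine ⟨N.real_smul_mem c hu, smul_nonneg hc hu0, ?_, ?_⟩
    · rw [this]; exact ENNReal.mul_lt_top ENNReal.ofReal_lt_top huf
    · rw [this, ENNReal.toReal_mul, ENNReal.toReal_ofReal hc]
  rw [hτ.saTrace_sub hu hv hu0 hv0 huf hvf]
  rcases le_total 0 c with hc | hc
  · obtain ⟨h1, h2, h3, h4⟩ := key c hc u hu hu0 huf
    obtain ⟨k1, k2, k3, k4⟩ := key c hc v hv hv0 hvf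
    refine ⟨⟨_, h1, _, k1, h2, k2, h3, k3, smul_sub _ _ _⟩, ?_⟩
    rw [smul_sub, hτ.saTrace_sub h1 k1 h2 k2 h3 k3, h4, k4]
    ring
  · have hc' : 0 ≤ -c := by linarith
    obtain ⟨h1, h2, h3, h4⟩ := key (-c) hc' u hu hu0 huf
    obtain ⟨k1, k2, k3, k4⟩ := key (-c) hc' v hv hv0 hvf
    have e : c • (u - v) = (-c) • v - (-c) • u := by rw [smul_sub, neg_smul, neg_smul]; abel
    refine ⟨⟨_, k1, _, h1, k2, h2, k3, h3, e⟩, ?_⟩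
    rw [e, hτ.saTrace_sub k1 h1 k2 h2 k3 h3, h4, k4]
    ring

/-- Polarization: `4 Re(a p b) = (a + b*) p (a + b*)* - (a - b*) p (a - b*)*`. -/
theorem isTraceDiff_realPart_generator {y : H →L[ℂ] H} (hy : y ∈ finiteGenerators N τ) :
    IsTraceDiff N τ (realPart y : H →L[ℂ] H) := by
  obtain ⟨a, ha, b, hb, p, hp, hp1, hp2, rfl⟩ := hy
  have hp0 : 0 ≤ p := hp1.nonneg
  have hconj : ∀ c ∈ N, c * p * star c ∈ N ∧ 0 ≤ c * p * star c ∧ τ (c * p * star c) < ∞ :=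
    fun c hc => ⟨mul_mem (mul_mem hc hp) (star_mem hc), star_right_conjugate_nonneg hp0 c,
      (hτ.conjugate_le hc hp hp0).trans_lt (ENNReal.mul_lt_top ENNReal.ofReal_lt_top hp2)⟩
  obtain ⟨h1, h2, h3⟩ := hconj (a + star b) (add_mem ha (star_mem hb))
  obtain ⟨k1, k2, k3⟩ := hconj (a - star b) (sub_mem ha (star_mem hb))
  have e : (realPart (a * p * b) : H →L[ℂ] H) = (1 / 4 : ℝ) •
      ((a + star b) * p * star (a + star b) - (a - star b) * p * star (a - star b)) := by
    have : (a + star b) * p * star (a + star b) - (a - star b) * p * star (a - star b) =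
        (2 : ℝ) • (a * p * b + star (a * p * b)) := by
      rw [two_smul, star_add, star_sub, star_star, star_mul, star_mul, hp1.isSelfAdjoint.star_eq]
      noncomm_ring
    rw [this, smul_smul, realPart_apply_coe]
    norm_num
  rw [e]
  exact (hτ.isTraceDiff_smul _ ⟨_, h1, _, k1, h2, k2, h3, k3, rfl⟩).1

theorem isTraceDiff_of_mem_finiteIdeal {x : H →L[ℂ] H} (hx : x ∈ finiteIdeal N τ) :
    IsTraceDiff N τ (realPart x : H →L[ℂ] H) ∧
      IsTraceDiff N τ (imaginaryPart x : H →L[ℂ] H) := by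
  change x ∈ Submodule.span ℂ (finiteGenerators N τ) at hx
  induction hx using Submodule.span_induction with
  | mem y hy =>
    refine ⟨hτ.isTraceDiff_realPart_generator hy, ?_⟩
    -- The imaginary part of `y` is minus the real part of `i y`, again a generator.
    have h1 : Complex.I • y ∈ finiteGenerators N τ := by
      obtain ⟨a, ha, b, hb, p, hp, hp1, hp2, rfl⟩ := hy
      exact ⟨Complex.I • a, N.smul_mem _ ha, b, hb, p, hp, hp1, hp2, by
        rw [smul_mul_assoc, smul_mul_assoc]⟩
    have h2 := (hτ.isTraceDiff_smul (-1) (hτ.isTraceDiff_realPart_generator h1)).1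
    rw [realPart_I_smul] at h2
    simpa using h2
  | zero =>
    have h0 : IsTraceDiff N τ 0 := ⟨0, zero_mem N, 0, zero_mem N, le_rfl, le_rfl,
      by simp [hτ.map_zero], by simp [hτ.map_zero], by simp⟩
    simpa using h0
  | add x y _ _ hx hy =>
    rw [map_add, map_add, AddSubgroup.coe_add, AddSubgroup.coe_add]
    exact ⟨(hτ.isTraceDiff_add hx.1 hy.1).1, (hτ.isTraceDiff_add hx.2 hy.2).1⟩
  | smul c x _ hx =>
    rw [coe_realPart_smul, coe_imaginaryPart_smul]
    exact ⟨(hτ.isTraceDiff_add (hτ.isTraceDiff_smul _ hx.1).1 (hτ.isTraceDiff_smul _ hx.2).1).1,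
      (hτ.isTraceDiff_add (hτ.isTraceDiff_smul _ hx.2).1 (hτ.isTraceDiff_smul _ hx.1).1).1⟩

theorem lt_top_of_mem_finiteIdeal {x : H →L[ℂ] H} (hx : x ∈ finiteIdeal N τ) (h0 : 0 ≤ x) :
    τ x < ∞ := by
  have h1 := (hτ.isTraceDiff_of_mem_finiteIdeal hx).1
  rw [h0.isSelfAdjoint.coe_realPart] at h1
  obtain ⟨u, hu, v, hv, hu0, hv0, huf, hvf, hxuv⟩ := h1
  refine (hτ.mono (by rw [hxuv]; exact sub_mem hu hv) hu h0 ?_).trans_lt huf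
  rw [hxuv]
  exact sub_le_self _ hv0

theorem linTrace_add {x y : H →L[ℂ] H} (hx : x ∈ finiteIdeal N τ) (hy : y ∈ finiteIdeal N τ) :
    linTrace τ (x + y) = linTrace τ x + linTrace τ y := by
  obtain ⟨hx1, hx2⟩ := hτ.isTraceDiff_of_mem_finiteIdeal hx
  obtain ⟨hy1, hy2⟩ := hτ.isTraceDiff_of_mem_finiteIdeal hy
  rw [linTrace_eq, linTrace_eq, linTrace_eq, map_add, map_add, AddSubgroup.coe_add,
    AddSubgroup.coe_add, (hτ.isTraceDiff_add hx1 hy1).2, (hτ.isTraceDiff_add hx2 hy2).2]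
  push_cast
  ring

theorem linTrace_smul (c : ℂ) {x : H →L[ℂ] H} (hx : x ∈ finiteIdeal N τ) :
    linTrace τ (c • x) = c * linTrace τ x := by
  obtain ⟨hx1, hx2⟩ := hτ.isTraceDiff_of_mem_finiteIdeal hx
  rw [linTrace_eq, linTrace_eq, coe_realPart_smul, coe_imaginaryPart_smul]
  rw [(hτ.isTraceDiff_add (hτ.isTraceDiff_smul _ hx1).1 (hτ.isTraceDiff_smul _ hx2).1).2,
    (hτ.isTraceDiff_add (hτ.isTraceDiff_smul _ hx2).1 (hτ.isTraceDiff_smul _ hx1).1).2,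
    (hτ.isTraceDiff_smul _ hx1).2, (hτ.isTraceDiff_smul _ hx2).2, (hτ.isTraceDiff_smul _ hx1).2,
    (hτ.isTraceDiff_smul _ hx2).2]
  apply Complex.ext <;> simp
  ring

theorem linTrace_of_nonneg {x : H →L[ℂ] H} (hx : 0 ≤ x) :
    linTrace τ x = ((τ x).toReal : ℂ) := by
  rw [linTrace_of_isSelfAdjoint hx.isSelfAdjoint, saTrace, (CFC.posPart_eq_self x).2 hx,
    (CFC.negPart_eq_zero_iff x hx.isSelfAdjoint).2 hx, hτ.map_zero]
  simp

omit hτ in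
theorem finiteIdeal_le {x : H →L[ℂ] H} (hx : x ∈ finiteIdeal N τ) : x ∈ N := by
  change x ∈ Submodule.span ℂ (finiteGenerators N τ) at hx
  induction hx using Submodule.span_induction with
  | mem y hy =>
    obtain ⟨a, ha, b, hb, p, hp, -, -, rfl⟩ := hy
    exact mul_mem (mul_mem ha hp) hb
  | zero => exact zero_mem N
  | add x y _ _ hx hy => exact add_mem hx hy
  | smul c x _ hx => exact N.smul_mem c hx

omit hτ in
theorem tauCompact_le {x : H →L[ℂ] H} (hx : x ∈ tauCompact N τ) : x ∈ N := by
  have h1 : closure (finiteIdeal N τ : Set (H →L[ℂ] H)) ⊆ N :=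
    closure_minimal (fun _ h => finiteIdeal_le h) N.isClosed
  exact h1 hx

omit hτ in
theorem mul_mem_finiteIdeal_left {a x : H →L[ℂ] H} (ha : a ∈ N) (hx : x ∈ finiteIdeal N τ) :
    a * x ∈ finiteIdeal N τ := by
  change x ∈ Submodule.span ℂ (finiteGenerators N τ) at hx
  change a * x ∈ Submodule.span ℂ (finiteGenerators N τ)
  induction hx using Submodule.span_induction with
  | mem y hy =>
    obtain ⟨c, hc, b, hb, p, hp, hp1, hp2, rfl⟩ := hy
    exact Submodule.subset_span ⟨a * c, mul_mem ha hc, b, hb, p, hp, hp1, hp2,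
      by simp only [mul_assoc]⟩
  | zero => simp
  | add x y _ _ hx hy => rw [mul_add]; exact add_mem hx hy
  | smul c x _ hx => rw [mul_smul_comm]; exact Submodule.smul_mem _ _ hx

omit hτ in
theorem mul_mem_finiteIdeal_right {a x : H →L[ℂ] H} (ha : a ∈ N) (hx : x ∈ finiteIdeal N τ) :
    x * a ∈ finiteIdeal N τ := by
  have := star_mem (mul_mem_finiteIdeal_left (star_mem ha) (star_mem hx))
  simpa using this

/-- With `y = b*`, polarization writes `x b*` and `b* x` as the same combination of terms `z z*` and
`z* z` respectively, and `τ` agrees on these. -/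
theorem linTrace_mul_comm {x y : H →L[ℂ] H} (hx : x ∈ finiteIdeal N τ)
    (hy : y ∈ finiteIdeal N τ) : linTrace τ (x * y) = linTrace τ (y * x) := by
  have hsq : ∀ z ∈ finiteIdeal N τ, linTrace τ (z * star z) = linTrace τ (star z * z) := by
    intro z hz
    rw [hτ.linTrace_of_nonneg (mul_star_self_nonneg z),
      hτ.linTrace_of_nonneg (star_mul_self_nonneg z), hτ.trace z (finiteIdeal_le hz)]
  obtain ⟨b, rfl⟩ : ∃ b, star b = y := ⟨star y, star_star y⟩
  have hb : b ∈ finiteIdeal N τ := by simpa using star_mem hy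
  have e1 : (4 : ℂ) • (x * star b) = (x + b) * star (x + b) + (-1 : ℂ) • ((x - b) * star (x - b)) +
      Complex.I • ((x + Complex.I • b) * star (x + Complex.I • b)) +
      (-Complex.I) • ((x - Complex.I • b) * star (x - Complex.I • b)) := by
    simp only [star_add, star_sub, star_smul, add_mul, mul_add, sub_mul, mul_sub, smul_mul_assoc,
      mul_smul_comm, smul_add, smul_sub, smul_smul, Complex.star_def, Complex.conj_I]
    ring_nf
    simp only [Complex.I_sq]
    module
  have e2 : (4 : ℂ) • (star b * x) = star (x + b) * (x + b) + (-1 : ℂ) • (star (x - b) * (x - b)) +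
      Complex.I • (star (x + Complex.I • b) * (x + Complex.I • b)) +
      (-Complex.I) • (star (x - Complex.I • b) * (x - Complex.I • b)) := by
    simp only [star_add, star_sub, star_smul, add_mul, mul_add, sub_mul, mul_sub, smul_mul_assoc,
      mul_smul_comm, smul_add, smul_sub, smul_smul, Complex.star_def, Complex.conj_I]
    ring_nf
    simp only [Complex.I_sq]
    module
  have hI : Complex.I • b ∈ finiteIdeal N τ := SMulMemClass.smul_mem _ hb
  have hexp : ∀ a₁ ∈ finiteIdeal N τ, ∀ a₂ ∈ finiteIdeal N τ, ∀ a₃ ∈ finiteIdeal N τ,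
      ∀ a₄ ∈ finiteIdeal N τ, linTrace τ (a₁ + (-1 : ℂ) • a₂ + Complex.I • a₃ +
        (-Complex.I) • a₄) = linTrace τ a₁ + (-1) * linTrace τ a₂ + Complex.I * linTrace τ a₃ +
          (-Complex.I) * linTrace τ a₄ := by
    intro a₁ h1 a₂ h2 a₃ h3 a₄ h4
    have k2 : (-1 : ℂ) • a₂ ∈ finiteIdeal N τ := SMulMemClass.smul_mem _ h2
    have k3 : Complex.I • a₃ ∈ finiteIdeal N τ := SMulMemClass.smul_mem _ h3
    have k4 : (-Complex.I) • a₄ ∈ finiteIdeal N τ := SMulMemClass.smul_mem _ h4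
    rw [hτ.linTrace_add (add_mem (add_mem h1 k2) k3) k4, hτ.linTrace_add (add_mem h1 k2) k3,
      hτ.linTrace_add h1 k2, hτ.linTrace_smul _ h2, hτ.linTrace_smul _ h3, hτ.linTrace_smul _ h4]
  have m : ∀ z ∈ finiteIdeal N τ, z * star z ∈ finiteIdeal N τ := fun z hz =>
    mul_mem hz (star_mem hz)
  have m' : ∀ z ∈ finiteIdeal N τ, star z * z ∈ finiteIdeal N τ := fun z hz =>
    mul_mem (star_mem hz) hz
  have z1 := add_mem hx hb
  have z2 := sub_mem hx hb
  have z3 := add_mem hx hI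
  have z4 := sub_mem hx hI
  have f1 := congr_arg (linTrace τ) e1
  have f2 := congr_arg (linTrace τ) e2
  rw [hexp _ (m _ z1) _ (m _ z2) _ (m _ z3) _ (m _ z4), hsq _ z1, hsq _ z2, hsq _ z3, hsq _ z4,
    hτ.linTrace_smul _ (mul_mem hx hy)] at f1
  rw [hexp _ (m' _ z1) _ (m' _ z2) _ (m' _ z3) _ (m' _ z4), hτ.linTrace_smul _ (mul_mem hy hx),
    ← f1] at f2
  exact (mul_left_cancel₀ (by norm_num) f2).symm

end IsFNSTrace

end Traces

/-! ### Application to the `τ`-compact operators. -/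

section Main

variable {H : Type*} [NormedAddCommGroup H] [InnerProductSpace ℂ H] [CompleteSpace H]

/-- Used as an instance: closedness is what makes `tauCompact N τ` a C*-algebra. -/
theorem isClosed_tauCompact (N : VonNeumannAlgebra H) (τ : (H →L[ℂ] H) → ℝ≥0∞) :
    IsClosed (tauCompact N τ : Set (H →L[ℂ] H)) :=
  NonUnitalStarSubalgebra.isClosed_topologicalClosure _

attribute [local instance] isClosed_tauCompact

/-- The ideal of finite elements, inside the algebra of trace-compact operators. -/
def finiteSubmodule (N : VonNeumannAlgebra H) (τ : (H →L[ℂ] H) → ℝ≥0∞) :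
    Submodule ℂ (tauCompact N τ) where
  carrier := {x | (x : H →L[ℂ] H) ∈ finiteIdeal N τ}
  add_mem' := fun hx hy => (finiteIdeal N τ).toSubmodule.add_mem hx hy
  zero_mem' := (finiteIdeal N τ).toSubmodule.zero_mem
  smul_mem' := fun c _ hx => (finiteIdeal N τ).toSubmodule.smul_mem c hx

variable {N : VonNeumannAlgebra H} {τ : (H →L[ℂ] H) → ℝ≥0∞}

theorem IsFNSTrace.isDenseTraceIdeal (hτ : IsFNSTrace N τ) :
    IsDenseTraceIdeal (finiteSubmodule N τ) (fun x => linTrace τ (x : H →L[ℂ] H)) where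
  dense := by
    rintro ⟨x, hx⟩
    rw [closure_subtype]
    have h1 : x ∈ closure (finiteIdeal N τ : Set (H →L[ℂ] H)) := hx
    refine closure_mono ?_ h1
    intro y hy
    exact ⟨⟨y, NonUnitalStarSubalgebra.le_topologicalClosure _ hy⟩, hy, rfl⟩
  mul_mem_left a x hx := IsFNSTrace.mul_mem_finiteIdeal_left (IsFNSTrace.tauCompact_le a.2) hx
  mul_mem_right a x hx := IsFNSTrace.mul_mem_finiteIdeal_right (IsFNSTrace.tauCompact_le a.2) hx
  star_mem x hx := (finiteIdeal N τ).star_mem' hx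
  map_add x hx y hy := hτ.linTrace_add hx hy
  map_smul c x hx := hτ.linTrace_smul c hx
  map_mul_comm x hx y hy := hτ.linTrace_mul_comm hx hy
  im_eq_zero x hx hsa := by
    have h1 : IsSelfAdjoint (x : H →L[ℂ] H) := congr_arg Subtype.val hsa
    rw [linTrace_of_isSelfAdjoint h1, Complex.ofReal_im]

/-- Projections over the trace-compact operators have entries in the ideal of finite elements. -/
theorem IsFNSTrace.mem_finiteIdeal_of_isStarProjection (hτ : IsFNSTrace N τ) {n : ℕ}
    {p : Matrix (Fin n) (Fin n) (tauCompact N τ)} (hp : IsStarProjection p) (i j : Fin n) :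
    (p i j : H →L[ℂ] H) ∈ finiteIdeal N τ := by
  let P : Matrix (Fin n) (Fin n) (Unitization ℂ (tauCompact N τ)) := p.map Unitization.inr
  have hpp : p * p = p := hp.isIdempotentElem
  have hPP : P * P = P := by
    have h := Matrix.map_mul (f := Unitization.inrNonUnitalAlgHom ℂ (tauCompact N τ)) (L := p)
      (M := p)
    rw [hpp] at h
    exact h.symm
  have hP0 : scalarMat P = 0 := by
    ext i j
    simp [P]
  exact ((hτ.isDenseTraceIdeal.inF_of_isIdempotentElem hPP hP0) i j).2

theorem IsFNSTrace.sum_lt_top_of_isStarProjection (hτ : IsFNSTrace N τ) {n : ℕ}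
    {p : Matrix (Fin n) (Fin n) (tauCompact N τ)} (hp : IsStarProjection p) :
    ∑ i, τ (p i i : H →L[ℂ] H) < ∞ := by
  refine ENNReal.sum_lt_top.2 fun i _ =>
    hτ.lt_top_of_mem_finiteIdeal (hτ.mem_finiteIdeal_of_isStarProjection hp i i) ?_
  have hpp : p * p = p := hp.isIdempotentElem
  have hps : p.conjTranspose = p := hp.isSelfAdjoint
  -- Since `p = p* p`, the diagonal entries are sums of positive elements.
  have h1 : p i i = ∑ k, star (p k i) * p k i := by
    conv_lhs => rw [← hpp]
    rw [Matrix.mul_apply]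
    refine Finset.sum_congr rfl fun k _ => ?_
    rw [← Matrix.conjTranspose_apply, hps]
  rw [h1, AddSubmonoidClass.coe_finsetSum]
  exact Finset.sum_nonneg fun k _ => star_mul_self_nonneg (p k i : H →L[ℂ] H)

end Main

end

theorem mainTheorem12 {H : Type*} [NormedAddCommGroup H] [InnerProductSpace ℂ H] [CompleteSpace H]
    (N : VonNeumannAlgebra H) (τ : (H →L[ℂ] H) → ℝ≥0∞) (hτ : IsFNSTrace N τ) :
    (∀ (n : ℕ) (p : Matrix (Fin n) (Fin n) (tauCompact N τ)), IsStarProjection p →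
      (∀ i j, (p i j : H →L[ℂ] H) ∈ finiteIdeal N τ) ∧
      ∑ i, τ (p i i : H →L[ℂ] H) < ∞) ∧
    ∃! τs : KZero (tauCompact N τ) →+ ℝ,
      ∀ (n : ℕ) (p q : Matrix (Fin n) (Fin n) (Unitization ℂ (tauCompact N τ)))
        (hp : IsStarProjection p) (hq : IsStarProjection q),
        (∀ i j, ((p i j).snd : H →L[ℂ] H) ∈ finiteIdeal N τ) →
        (∀ i j, ((q i j).snd : H →L[ℂ] H) ∈ finiteIdeal N τ) →
        ∀ h : KZeroUnital.mk (ProjMat.map (scalarPart (tauCompact N τ)) ⟨n, p, hp⟩) =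
            KZeroUnital.mk (ProjMat.map (scalarPart (tauCompact N τ)) ⟨n, q, hq⟩),
          ((τs (KZero.diff ⟨n, p, hp⟩ ⟨n, q, hq⟩ h) : ℝ) : ℂ) =
            matTrace τ (Matrix.of fun i j => ((p i j).snd : H →L[ℂ] H)) -
            matTrace τ (Matrix.of fun i j => ((q i j).snd : H →L[ℂ] H)) := by
  have := isClosed_tauCompact N τ
  exact ⟨fun _ _ hp =>
      ⟨hτ.mem_finiteIdeal_of_isStarProjection hp, hτ.sum_lt_top_of_isStarProjection hp⟩,
    hτ.isDenseTraceIdeal.existsUnique_kZero_trace⟩
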